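/- Let $\Bbbk$ be a field and let $\mathbf M$ be the category of nonnegatively graded chain complexes of $\Bbbk$-vector spaces that are finite dimensional in each degree, with the usual tensor product of chain complexes. It carries the model structure in which the weak equivalences are the quasi-isomorphisms, the cofibrations are the degreewise injections and the fibrations are the chain maps that are surjective in positive degrees. For $n\ge 0$ let $S^n\in\mathbf M$ be $\Bbbk$ concentrated in degree $n$, and for $n\geq 1$ let $D^n\in\mathbf M$ be the complex with basis $x_{n-1}$, $y_n$ in degrees $n-1$, $n$ and $dy_n=x_{n-1}$; let $p_n:D^n\to S^n$ be the projection. Put $$\mathsf X=\{p_n:D^n\to S^n\mid n\ge 1\}\cup\{0\to S^0\}\cup\{S^n\to 0\mid n\ge 0\},\qquad \mathsf Z=\{D^n\to 0\mid n\ge 1\}.$$ For a class $\mathsf Y$ of morphisms in a category, a $\mathsf Y$-Postnikov tower is a morphism $\lim_{\beta<\lambda}Y_\beta\to Y_0$, where $\lambda>0$ is an ordinal, $Y$ is a $\lambda^{op}$-indexed diagram in which each $Y_{\beta+1}\to Y_\beta$ is a pullback of a morphism in $\mathsf Y$ and $Y_\gamma=\lim_{\beta<\gamma}Y_\beta$ for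 limit ordinals $\gamma<\lambda$, and the limit $\lim_{\beta<\lambda}Y_\beta$ exists. Let $\mathsf{Post}_{\mathsf Y}$ be the class of these morphisms and $\widehat{\mathsf{Post}_{\mathsf Y}}$ its closure under retracts. A Postnikov presentation of a model category is a pair $(\mathsf Y,\mathsf Y')$ of classes of morphisms such that the fibrations are exactly $\widehat{\mathsf{Post}_{\mathsf Y}}$, the acyclic fibrations are exactly $\widehat{\mathsf{Post}_{\mathsf Y'}}$, and every morphism factors both as a cofibration followed by an element of $\mathsf{Post}_{\mathsf Y'}$ and as an acyclic cofibration followed by an element of $\mathsf{Post}_{\mathsf Y}$. **Theorem.** Let $C$ be a coaugmented comonoid in $\mathbf M$ (a coaugmented chain coalgebra) that is $1$-connected, i.e., $C_0=\Bbbk$ and $C_1=0$. Let $\mathbf{Comod}_C$ be the category of right $C$-comodules in $\mathbf M$, $U_C:\mathbf{Comod}_C\to\mathbf M$ the forgetful functor and $-\otimes C:\mathbf M\to\mathbf{Comod}_C$ the cofree comodule functor. Then there is a model structure on $\mathbf{Comod}_C$ left-induced by $U_C$, that is, a morphism $f$ of $\mathbf{Comod}_C$ is a weak equivalence (respectively,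 a cofibration) if and only if $U_Cf$ is one in $\mathbf M$, i.e., is a quasi-isomorphism (respectively, a degreewise injection); and $(\mathsf X\otimes C,\mathsf Z\otimes C)$ is a Postnikov presentation of this model structure, where $\mathsf X\otimes C=\{x\otimes C\mid x\in\mathsf X\}$ and $\mathsf Z\otimes C=\{z\otimes C\mid z\in\mathsf Z\}$. -/

import Mathlib

open CategoryTheory MonoidalCategory HomotopicalAlgebra

universe w v v' u u'

noncomputable section

/-! ## Comodules over a comonoid in a monoidal category -/

open scoped ComonObj in
/-- A right comodule over a comonoid `C` in a monoidal category `M`: an object `X` with a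
coassociative and counital coaction `X ⟶ X ⊗ C`. -/
structure RightComodule {M : Type u} [Category.{v} M] [MonoidalCategory M]
    (C : M) [ComonObj C] where
  X : M
  coact : X ⟶ X ⊗ C
  coact_coassoc : coact ≫ coact ▷ C ≫ (α_ X C C).hom = coact ≫ X ◁ Δ[C]
  coact_counit : coact ≫ X ◁ ε[C] = (ρ_ X).inv

namespace RightComodule

variable {M : Type u} [Category.{v} M] [MonoidalCategory M] {C : M} [ComonObj C]

/-- A morphism of right comodules: a morphism in `M` commuting with the coactions. -/
@[ext]
structure Hom (N N' : RightComodule C) where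
  hom : N.X ⟶ N'.X
  comm : N.coact ≫ hom ▷ C = hom ≫ N'.coact

instance : Category (RightComodule C) where
  Hom N N' := Hom N N'
  id N := ⟨𝟙 N.X, by simp⟩
  comp f g := ⟨f.hom ≫ g.hom, by
    rw [comp_whiskerRight, ← Category.assoc, f.comm, Category.assoc, g.comm, Category.assoc]⟩

@[simp]
lemma id_hom (N : RightComodule C) : Hom.hom (𝟙 N) = 𝟙 N.X := rfl

@[simp]
lemma comp_hom {N N' N'' : RightComodule C} (f : N ⟶ N') (g : N' ⟶ N'') :
    Hom.hom (f ≫ g) = Hom.hom f ≫ Hom.hom g := rfl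

@[ext]
lemma hom_ext {N N' : RightComodule C} {f g : N ⟶ N'} (h : Hom.hom f = Hom.hom g) : f = g :=
  Hom.ext h

variable (C)

/-- The forgetful functor from right `C`-comodules to `M`. -/
@[simps]
abbrev forget : RightComodule C ⥤ M where
  obj N := N.X
  map f := Hom.hom f

open scoped ComonObj in
/-- The cofree comodule `X ⊗ C`, with coaction `X ⊗ Δ` (up to the associator). -/
@[simps]
abbrev cofreeObj (X : M) : RightComodule C where
  X := X ⊗ C
  coact := X ◁ Δ[C] ≫ (α_ X C C).inv
  coact_coassoc := by
    have h : X ◁ Δ[C] ≫ X ◁ C ◁ Δ[C] = X ◁ Δ[C] ≫ X ◁ Δ[C] ▷ C ≫ X ◁ (α_ C C C).hom := by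
      simp only [← whiskerLeft_comp, ComonObj.comul_assoc]
    rw [← cancel_mono (α_ X C (C ⊗ C)).hom]
    simpa using h.symm
  coact_counit := by
    have h : X ◁ Δ[C] ≫ X ◁ C ◁ ε[C] = X ◁ (ρ_ C).inv := by
      simp only [← whiskerLeft_comp, ComonObj.comul_counit]
    rw [← cancel_mono (α_ X C (𝟙_ M)).hom]
    simpa using h

open scoped ComonObj in
/-- The cofree comodule functor `- ⊗ C`. -/
@[simps]
abbrev cofree : M ⥤ RightComodule C where
  obj X := cofreeObj C X
  map {X Y} f := ⟨f ▷ C, by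
    have h : (X ◁ Δ[C] ≫ (α_ X C C).inv) ≫ f ▷ C ▷ C =
        f ▷ C ≫ Y ◁ Δ[C] ≫ (α_ Y C C).inv := by
      rw [Category.assoc, ← associator_inv_naturality_left, whisker_exchange_assoc]
    exact h⟩
  map_id X := hom_ext (id_whiskerRight X C)
  map_comp f g := hom_ext (comp_whiskerRight f g C)

end RightComodule

open scoped ComonObj in
/-- A coaugmentation of a comonoid `C`: a morphism of comonoids from the unit object, whose
comultiplication is the canonical isomorphism, to `C`. -/
structure Coaugmentation {M : Type u} [Category.{v} M] [MonoidalCategory M]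
    (C : M) [ComonObj C] where
  η : 𝟙_ M ⟶ C
  η_counit : η ≫ ε[C] = 𝟙 (𝟙_ M)
  η_comul : η ≫ Δ[C] = (λ_ (𝟙_ M)).inv ≫ (η ⊗ₘ η)

/-! ## Postnikov towers and left-induced model structures -/

/-- The class of `X`-Postnikov towers: the morphisms `lim_{λᵒᵖ} Y ⟶ Y₀`, where `λ` is a nonempty
well-ordered set, `Y : λᵒᵖ ⥤ C` has each `Y_{β+1} ⟶ Y_β` a pullback of a morphism of `X`,
`Y_γ = lim_{β < γ} Y_β` for limit elements `γ`, and the limit of `Y` exists. In other words,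
transfinite compositions, taken in `Cᵒᵖ`, of pullbacks of morphisms of `X`. -/
def postnikovTowers {C : Type u} [Category.{v} C] (X : MorphismProperty C) : MorphismProperty C :=
  (MorphismProperty.transfiniteCompositions.{w} X.pullbacks.op).unop

/-- A Postnikov presentation `(X, Z)` of a model category. -/
structure IsPostnikovPresentation {C : Type u} [Category.{v} C] [ModelCategory C]
    (X Z : MorphismProperty C) : Prop where
  fibrations_eq : fibrations C = (postnikovTowers.{w} X).retracts
  trivialFibrations_eq : trivialFibrations C = (postnikovTowers.{w} Z).retracts
  factorization_cof : MorphismProperty.HasFactorization (cofibrations C) (postnikovTowers.{w} Z)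
  factorization_trivialCof :
    MorphismProperty.HasFactorization (trivialCofibrations C) (postnikovTowers.{w} X)

/-- The model structure on `C` is left-induced from that of `D` along `F : C ⥤ D`. -/
structure IsLeftInduced {C : Type u} [Category.{v} C] {D : Type u'} [Category.{v'} D]
    [ModelCategory C] [ModelCategory D] (F : C ⥤ D) : Prop where
  weakEquivalences_eq : weakEquivalences C = (weakEquivalences D).inverseImage F
  cofibrations_eq : cofibrations C = (cofibrations D).inverseImage F

/-! ## Finite-type chain complexes -/

/-- The (nonnegatively graded) chain complexes which are finite dimensional in each degree. -/
def finiteType (k : Type u) [Field k] : ObjectProperty (ChainComplex (ModuleCat.{u} k) ℕ) :=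
  fun K => ∀ n, Module.Finite k (K.X n)

lemma finite_of_isZero {k : Type u} [Field k] {V : ModuleCat.{u} k} (h : Limits.IsZero V) :
    Module.Finite k V := by
  have := ModuleCat.subsingleton_of_isZero h
  infer_instance

open scoped ZeroObject in
lemma finiteType_zero (k : Type u) [Field k] :
    finiteType k (0 : ChainComplex (ModuleCat.{u} k) ℕ) := fun n =>
  finite_of_isZero ((HomologicalComplex.eval _ _ n).map_isZero (Limits.isZero_zero _))

lemma finiteType_single (k : Type u) [Field k] (n : ℕ) :
    finiteType k ((HomologicalComplex.single (ModuleCat.{u} k) (ComplexShape.down ℕ) n).obj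
      (ModuleCat.of k k)) := by
  intro m
  by_cases h : m = n
  · subst h
    exact Module.Finite.equiv (HomologicalComplex.singleObjXSelf _ m
      (ModuleCat.of k k)).symm.toLinearEquiv
  · exact finite_of_isZero (HomologicalComplex.isZero_single_obj_X _ _ _ _ h)

lemma finiteType_tensor {k : Type u} [Field k] {K L : ChainComplex (ModuleCat.{u} k) ℕ}
    (hK : finiteType k K) (hL : finiteType k L) : finiteType k (K ⊗ L) := by
  intro n
  let S : Submodule k ((K ⊗ L).X n : ModuleCat.{u} k) :=
    ⨆ p : Finset.HasAntidiagonal.antidiagonal n, LinearMap.range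
      (HomologicalComplex.ιTensorObj K L p.1.1 p.1.2 n (Finset.HasAntidiagonal.mem_antidiagonal.1 p.2)).hom
  have hS : S = ⊤ := by
    have h : ModuleCat.ofHom S.mkQ = 0 := by
      refine HomologicalComplex.mapBifunctor.hom_ext (fun i j hij => ?_)
      ext x
      exact (Submodule.Quotient.mk_eq_zero S).2
        (Submodule.mem_iSup_of_mem
          (p := fun p : Finset.HasAntidiagonal.antidiagonal n => LinearMap.range
            (HomologicalComplex.ιTensorObj K L p.1.1 p.1.2 n
              (Finset.HasAntidiagonal.mem_antidiagonal.1 p.2)).hom)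
          ⟨(i, j), Finset.HasAntidiagonal.mem_antidiagonal.2 hij⟩ ⟨x, rfl⟩)
    have h' : S.mkQ = 0 := by simpa using congrArg ModuleCat.Hom.hom h
    rw [← Submodule.ker_mkQ S, h', LinearMap.ker_zero]
  have hfg : S.FG := by
    refine Submodule.fg_iSup _ (fun p => ?_)
    have := hK p.1.1
    have := hL p.1.2
    have : Module.Finite k ((K.X p.1.1 ⊗ L.X p.1.2 : ModuleCat.{u} k)) :=
      inferInstanceAs (Module.Finite k (TensorProduct k (K.X p.1.1) (L.X p.1.2)))
    rw [LinearMap.range_eq_map]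
    exact Module.Finite.fg_top.map _
  exact ⟨hS ▸ hfg⟩

instance (k : Type u) [Field k] : (finiteType k).IsMonoidal where
  prop_unit := finiteType_single k 0
  prop_tensor _ _ h₁ h₂ := finiteType_tensor h₁ h₂

/-- The category of finite-type nonnegatively graded chain complexes over `k`, with the
tensor product of chain complexes as monoidal structure. -/
abbrev FinTypeCh (k : Type u) [Field k] := (finiteType k).FullSubcategory

namespace FinTypeCh

variable (k : Type u) [Field k]

/-- Quasi-isomorphisms. -/
def quasiIsos : MorphismProperty (FinTypeCh k) :=
  fun _ _ f => QuasiIso f.hom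

/-- Chain maps that are injective in each degree. -/
def degreewiseInjections : MorphismProperty (FinTypeCh k) :=
  fun _ _ f => ∀ n, Function.Injective (f.hom.f n)

/-- Chain maps that are surjective in positive degrees. -/
def positiveSurjections : MorphismProperty (FinTypeCh k) :=
  fun _ _ f => ∀ n, 0 < n → Function.Surjective (f.hom.f n)

open scoped ZeroObject in
/-- The zero complex. -/
abbrev zero : FinTypeCh k := ⟨0, finiteType_zero k⟩

/-- The sphere `Sⁿ`: the field `k` in degree `n`. -/
abbrev sphere (n : ℕ) : FinTypeCh k :=
  ⟨(HomologicalComplex.single _ _ n).obj (ModuleCat.of k k), finiteType_single k n⟩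

lemma down_rel (n : ℕ) : (ComplexShape.down ℕ).Rel (n + 1) n := rfl

/-- The disk `Dⁿ⁺¹`: the complex `k = k` in degrees `n + 1` and `n`. -/
abbrev disk (n : ℕ) : FinTypeCh k :=
  ⟨HomologicalComplex.double (𝟙 (ModuleCat.of k k)) (down_rel n), by
    intro m
    by_cases h₀ : m = n + 1
    · subst h₀
      exact Module.Finite.equiv (HomologicalComplex.doubleXIso₀ (𝟙 (ModuleCat.of k k))
        (down_rel n)).symm.toLinearEquiv
    by_cases h₁ : m = n
    · subst h₁
      exact Module.Finite.equiv (HomologicalComplex.doubleXIso₁ (𝟙 (ModuleCat.of k k))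
        (down_rel m) (by simp)).symm.toLinearEquiv
    · exact finite_of_isZero (HomologicalComplex.isZero_double_X _ _ _ h₀ h₁)⟩

/-- The projection `pₙ₊₁ : Dⁿ⁺¹ ⟶ Sⁿ⁺¹`, the identity of `k` in degree `n + 1`. -/
def diskToSphere (n : ℕ) : disk k n ⟶ sphere k (n + 1) :=
  ObjectProperty.homMk (HomologicalComplex.mkHomFromDouble (down_rel n) (by simp)
    (HomologicalComplex.singleObjXSelf _ (n + 1) (ModuleCat.of k k)).inv 0
    (by
      dsimp only [sphere]
      rw [HomologicalComplex.single_obj_d, Limits.comp_zero]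
      exact Limits.comp_zero.symm) (by simp))

/-- The set `{pₙ : Dⁿ ⟶ Sⁿ | n ≥ 1} ∪ {p₀ : 0 ⟶ S⁰} ∪ {pₙ' : Sⁿ ⟶ 0 | n ≥ 0}`. -/
inductive generatingX : MorphismProperty (FinTypeCh k)
  | diskToSphere (n : ℕ) : generatingX (diskToSphere k n)
  | zeroToSphere : generatingX (ObjectProperty.homMk 0 : zero k ⟶ sphere k 0)
  | sphereToZero (n : ℕ) : generatingX (ObjectProperty.homMk 0 : sphere k n ⟶ zero k)

/-- The set `{qₙ : Dⁿ ⟶ 0 | n ≥ 1}`. -/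
inductive generatingZ : MorphismProperty (FinTypeCh k)
  | diskToZero (n : ℕ) : generatingZ (ObjectProperty.homMk 0 : disk k n ⟶ zero k)

variable {k} in
/-- `1`-connected: one dimensional in degree `0` and zero in degree `1`. -/
structure IsOneConnected (C : FinTypeCh k) : Prop where
  finrank_zero : Module.finrank k (C.obj.X 0) = 1
  subsingleton_one : Subsingleton (C.obj.X 1)

end FinTypeCh

end

/-! The theorem rests on two factorizations of an arbitrary comodule map `f : N ⟶ Y`:
`exists_fac_cofreeZ` (injection, then a tower) and `exists_fac_cofreeX` (injective
quasi-isomorphism, then a tower). The rest is formal. By the adjunction `forget ⊣ cofree` the cofree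
maps have the required right lifting properties, towers and their retracts inherit them, and the
retract argument turns the factorizations into the model structure and into the equalities defining
a Postnikov presentation.

Each factorization is a tower of corrections that remove one dimension of defect at a time. A kernel
element `x` of degree `n` is detected by a linear form on `N` in degree `n`. Such a form is the same
as a chain map from `N` to the disk in degrees `n`, `n + 1`, so `f` lifts to the product of `Y` with
the cofree comodule on this disk, and `x` leaves the kernel (`exists_disk_block`). A homology class
of the cokernel in degree `n` is represented by some `z` whose differential lies in the image of
`f`. A linear form nonzero on `z` and zero on the image of `f` and on boundaries is a chain map from
`Y` to a sphere. Pulling back the cofree map on `Dⁿ ⟶ Sⁿ` (or `0 ⟶ S⁰`) along its adjoint destroys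
the class, because `z` either acquires a new differential or does not lift at all
(`exists_kill_block`).

Connectivity of `C` enters through `isIso_counit_tensor_f`: if `K` vanishes below degree `m`, the
counit `K ⊗ C ⟶ K` is an isomorphism in degrees at most `m + 1`. In the degrees that matter, the
pullbacks are thus those of plain complexes, and a correction at degree `n` is bijective below
degree `n - 1`.

Always treating the lowest defective degree, finite dimensionality makes each degree perfect after
finitely many steps (`exists_process`). The tower is then eventually constant in each degree, so its
limit exists, is preserved by `- ⊗ C`, and lifts to comodules (`exists_isLimit_comodule`).

The maps `Dⁿ ⟶ 0` are not in the generating class for fibrations but factor as `Dⁿ ⟶ Sⁿ ⟶ 0`, which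
is why towers of double pullbacks appear. The model structure on complexes is obtained from the same
factorizations with `C` the unit comonoid. -/

noncomputable section

/-! ## Postnikov towers -/

namespace CategoryTheory

open Limits Opposite

section Towers

variable {C : Type u} [Category.{v} C]

/-- The projection of the limit of a sequence of pullbacks of morphisms of `W` to the first
object is a `W`-Postnikov tower. -/
lemma postnikovTowers_of_isLimit {W : MorphismProperty C} {X : ℕ → C}
    (f : ∀ n, X (n + 1) ⟶ X n) (hf : ∀ n, W.pullbacks (f n))
    {c : Cone (Functor.ofOpSequence f)} (hc : IsLimit c) :
    postnikovTowers.{w} W (c.π.app (op 0)) := by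
  have h : (W.pullbacks.op).TransfiniteCompositionOfShape ℕ (c.π.app (op 0)).op :=
    { F := Functor.ofSequence (fun n ↦ (f n).op)
      isoBot := Iso.refl _
      incl := (coconeOfConeLeftOp c).ι
      isColimit := isColimitCoconeOfConeLeftOp _ hc
      fac := Category.id_comp _
      map_mem := fun j _ ↦ by
        have := Functor.ofSequence_map_homOfLE_succ (fun n ↦ (f n).op) j
        erw [this]
        exact hf j }
  -- The indexing sets of towers live in universe `w`, so `ℕ` is replaced by an order-isomorphic
  -- copy there.
  exact MorphismProperty.transfiniteCompositionsOfShape_le_transfiniteCompositions _ _ _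
    (h.ofOrderIso (orderIsoShrink.{w} ℕ).symm).mem

/-- In the opposite category this is the stability of left lifting classes under transfinite
composition; pullbacks are handled by the stability of `L.rlp` under base change. -/
lemma postnikovTowers_le_rlp {W L : MorphismProperty C} (h : W ≤ L.rlp) :
    postnikovTowers.{w} W ≤ L.rlp := by
  have h₁ : W.pullbacks.op ≤ L.op.llp := by
    rintro A B f ⟨_, _, p, _, _, hp, sq⟩ X Y g hg
    have := MorphismProperty.of_isPullback (P := L.rlp) sq (h _ hp) _ hg
    exact (HasLiftingProperty.iff_unop f g).2 this
  intro A B f hf X Y g hg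
  have := MorphismProperty.transfiniteCompositions_monotone.{w} h₁ _ hf
  exact (HasLiftingProperty.iff_op).2
    (MorphismProperty.transfiniteCompositions_le _ _ this _ hg)

/-- A pullback of a composition is the composition of pullbacks. -/
lemma MorphismProperty.pullbacks_exists_fac [HasPullbacks C] {A B X Y Z : C} {q : A ⟶ B}
    {f : A ⟶ X} {u : X ⟶ Y} {v : Y ⟶ Z} {g : B ⟶ Z}
    (sq : IsPullback f q (u ≫ v) g) (W : MorphismProperty C) (hu : W u) (hv : W v) :
    ∃ (A' : C) (q₁ : A ⟶ A') (q₂ : A' ⟶ B), W.pullbacks q₁ ∧ W.pullbacks q₂ ∧ q₁ ≫ q₂ = q := by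
  have sq₂ := IsPullback.of_hasPullback v g
  refine ⟨_, sq₂.lift (f ≫ u) q (by simpa using sq.w), pullback.snd _ _,
    W.pullbacks_mk (f := f) (g := pullback.fst _ _) ?_ hu, W.pullbacks_mk sq₂ hv, by simp⟩
  exact IsPullback.of_bot (by simpa using sq) (by simp) sq₂

/-! ### Refining a tower whose steps are composites of two maps -/

section TwoSteps

variable {X Z : ℕ → C} (p : ∀ n, X (n + 1) ⟶ Z n) (q : ∀ n, Z n ⟶ X n)

/-- The objects `X₀, Z₀, X₁, Z₁, …`, indexed by `ℕ × Bool`. -/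
def interleaveObj (X Z : ℕ → C) : ℕ × Bool → C
  | (n, false) => X n
  | (n, true) => Z n

/-- The successor on the lexicographically ordered set `ℕ × Bool`. -/
def interleaveNext : ℕ × Bool → ℕ × Bool
  | (n, false) => (n, true)
  | (n, true) => (n + 1, false)

/-- The enumeration of `ℕ × Bool` in lexicographical order. -/
def interleaveIndex : ℕ → ℕ × Bool
  | 0 => (0, false)
  | n + 1 => interleaveNext (interleaveIndex n)

/-- The morphisms between consecutive objects of the sequence `X₀, Z₀, X₁, Z₁, …`. -/
def interleaveMap : ∀ s, interleaveObj X Z (interleaveNext s) ⟶ interleaveObj X Z s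
  | (n, false) => q n
  | (n, true) => p n

lemma interleaveIndex_two_mul (n : ℕ) : interleaveIndex (2 * n) = (n, false) := by
  induction n with
  | zero => rfl
  | succ n hn =>
    change interleaveNext (interleaveNext (interleaveIndex (2 * n))) = _
    rw [hn]
    rfl

/-- The sequence of morphisms `⋯ ⟶ Z₁ ⟶ X₁ ⟶ Z₀ ⟶ X₀`. -/
def interleaveSeq (n : ℕ) : interleaveObj X Z (interleaveIndex (n + 1)) ⟶
    interleaveObj X Z (interleaveIndex n) :=
  interleaveMap p q (interleaveIndex n)

/-- The diagram `⋯ ⟶ Z₁ ⟶ X₁ ⟶ Z₀ ⟶ X₀`. -/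
abbrev interleaveFunctor : ℕᵒᵖ ⥤ C :=
  Functor.ofOpSequence (X := fun n ↦ interleaveObj X Z (interleaveIndex n)) (interleaveSeq p q)

variable {p q} in
/-- The projections from a cone over `⋯ ⟶ X₁ ⟶ X₀` to the objects `X₀, Z₀, X₁, Z₁, …`. -/
def interleaveProj (c : Cone (Functor.ofOpSequence (fun n ↦ p n ≫ q n))) :
    ∀ s, c.pt ⟶ interleaveObj X Z s
  | (n, false) => c.π.app (op n)
  | (n, true) => c.π.app (op (n + 1)) ≫ p n

variable {p q} in
lemma cone_app_succ (c : Cone (Functor.ofOpSequence (fun n ↦ p n ≫ q n))) (n : ℕ) :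
    c.π.app (op (n + 1)) ≫ p n ≫ q n = c.π.app (op n) := by
  have := c.w (homOfLE (Nat.le_add_right n 1)).op
  rw [Functor.ofOpSequence_map_homOfLE_succ] at this
  exact this

variable {p q} in
lemma interleaveProj_comp (c : Cone (Functor.ofOpSequence (fun n ↦ p n ≫ q n))) :
    ∀ s, interleaveProj c (interleaveNext s) ≫ interleaveMap p q s = interleaveProj c s
  | (n, false) => (Category.assoc _ _ _).trans (cone_app_succ c n)
  | (_, true) => rfl

variable {p q} in
/-- The cone over the sequence `⋯ ⟶ Z₁ ⟶ X₁ ⟶ Z₀ ⟶ X₀` induced by a cone over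
`⋯ ⟶ X₁ ⟶ X₀`. -/
@[simps! pt]
def interleaveCone (c : Cone (Functor.ofOpSequence (fun n ↦ p n ≫ q n))) :
    Cone (interleaveFunctor p q) where
  pt := c.pt
  π := NatTrans.ofOpSequence (fun n ↦ interleaveProj c (interleaveIndex n)) (fun n ↦ by
    rw [Functor.ofOpSequence_map_homOfLE_succ]
    exact (Category.id_comp _).trans (interleaveProj_comp c (interleaveIndex n)).symm)

variable {p q} in
/-- The projection from a cone over `⋯ ⟶ Z₁ ⟶ X₁ ⟶ Z₀ ⟶ X₀` to the object with given index. -/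
def projOfInterleave (d : Cone (interleaveFunctor p q)) {n : ℕ} {s : ℕ × Bool}
    (h : interleaveIndex n = s) : d.pt ⟶ interleaveObj X Z s :=
  d.π.app (op n) ≫ eqToHom (congrArg (interleaveObj X Z) h)

variable {p q} in
lemma projOfInterleave_comp (d : Cone (interleaveFunctor p q)) {n : ℕ}
    {s : ℕ × Bool} (h : interleaveIndex n = s) (h' : interleaveIndex (n + 1) = interleaveNext s) :
    projOfInterleave d h' ≫ interleaveMap p q s = projOfInterleave d h := by
  subst h
  have := d.w (homOfLE (Nat.le_add_right n 1)).op
  rw [Functor.ofOpSequence_map_homOfLE_succ] at this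
  exact ((congrArg (· ≫ interleaveMap p q (interleaveIndex n)) (Category.comp_id _)).trans
    this).trans (Category.comp_id _).symm

variable {p q} in
/-- The cone over the sequence `⋯ ⟶ X₁ ⟶ X₀` induced by a cone over
`⋯ ⟶ Z₁ ⟶ X₁ ⟶ Z₀ ⟶ X₀`. -/
@[simps! pt]
def coneOfInterleave (d : Cone (interleaveFunctor p q)) :
    Cone (Functor.ofOpSequence (fun n ↦ p n ≫ q n)) where
  pt := d.pt
  π := NatTrans.ofOpSequence (fun n ↦ projOfInterleave d (interleaveIndex_two_mul n)) (fun n ↦ by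
    rw [Functor.ofOpSequence_map_homOfLE_succ]
    refine (Category.id_comp _).trans ?_
    have h : interleaveIndex (2 * n + 1) = (n, true) :=
      congrArg interleaveNext (interleaveIndex_two_mul n)
    have h₁ := projOfInterleave_comp d (interleaveIndex_two_mul n) h
    have h₂ := projOfInterleave_comp d h (interleaveIndex_two_mul (n + 1))
    exact h₁.symm.trans ((congrArg (· ≫ q n) h₂.symm).trans (Category.assoc _ _ _)))

variable {p q} in
/-- The limit of the sequence `⋯ ⟶ X₁ ⟶ X₀` is also the limit of
`⋯ ⟶ Z₁ ⟶ X₁ ⟶ Z₀ ⟶ X₀`. -/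
def isLimitInterleaveCone {c : Cone (Functor.ofOpSequence (fun n ↦ p n ≫ q n))}
    (hc : IsLimit c) : IsLimit (interleaveCone c) :=
  have key (d : Cone (interleaveFunctor p q)) (m : d.pt ⟶ c.pt)
      (hm : ∀ n, m ≫ c.π.app (op n) = projOfInterleave d (interleaveIndex_two_mul n)) (n : ℕ) :
      ∀ (s : ℕ × Bool) (h : interleaveIndex n = s),
        m ≫ interleaveProj c s = projOfInterleave d h := by
    have h₀ (i : ℕ) : interleaveIndex (2 * i + 1) = (i, true) :=
      congrArg interleaveNext (interleaveIndex_two_mul i)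
    intro s h
    -- Even indices are the hypothesis `hm`; at an odd index the projection factors through the next
    -- even stage.
    obtain ⟨i, rfl | rfl⟩ := Nat.even_or_odd' n
    · obtain rfl := h.symm.trans (interleaveIndex_two_mul i)
      exact hm i
    · obtain rfl := h.symm.trans (h₀ i)
      have h₂ := projOfInterleave_comp d (h₀ i) (interleaveIndex_two_mul (i + 1))
      exact (Category.assoc _ _ _).symm.trans ((congrArg (· ≫ p i) (hm (i + 1))).trans h₂)
  { lift := fun d ↦ hc.lift (coneOfInterleave d)
    fac := fun d ⟨n⟩ ↦ (key d _ (fun i ↦ hc.fac _ _) n _ rfl).trans (Category.comp_id _)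
    uniq := fun d m hm ↦ hc.hom_ext (fun ⟨n⟩ ↦ by
      refine Eq.trans ?_ (hc.fac (coneOfInterleave d) (op n)).symm
      refine Eq.trans ?_ (congrArg (· ≫ eqToHom (congrArg (interleaveObj X Z)
        (interleaveIndex_two_mul n))) (hm (op (2 * n))))
      have (s : ℕ × Bool) (h : interleaveIndex (2 * n) = s) : m ≫ interleaveProj c s =
          (m ≫ interleaveProj c (interleaveIndex (2 * n))) ≫
            eqToHom (congrArg (interleaveObj X Z) h) := by
        subst h
        simp
      exact this _ (interleaveIndex_two_mul n)) }

/-- Inserting the intermediate objects does not change the limit, and every step of the refined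
sequence is a single pullback. -/
lemma postnikovTowers_of_isLimit_comp {W : MorphismProperty C} (hp : ∀ n, W.pullbacks (p n))
    (hq : ∀ n, W.pullbacks (q n)) {c : Cone (Functor.ofOpSequence (fun n ↦ p n ≫ q n))}
    (hc : IsLimit c) : postnikovTowers.{w} W (c.π.app (op 0)) := by
  have h (s : ℕ × Bool) : W.pullbacks (interleaveMap p q s) := by
    obtain ⟨n, _ | _⟩ := s
    exacts [hq n, hp n]
  exact postnikovTowers_of_isLimit.{w} (interleaveSeq p q)
    (X := fun n ↦ interleaveObj X Z (interleaveIndex n)) (fun n ↦ h (interleaveIndex n))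
    (isLimitInterleaveCone hc)

end TwoSteps

end Towers

/-! ## Construction of model structures -/

section Model

variable {C : Type u} [Category.{v} C] {W I P L : MorphismProperty C}

/-- The retract argument: a map lifting against the left factor of its own factorization is a
retract of the right factor. -/
lemma rlp_eq_retracts_of_hasFactorization (hL : MorphismProperty.HasFactorization L P)
    (hP : P ≤ L.rlp) : L.rlp = P.retracts := by
  refine le_antisymm ?_ (fun _ _ f hf ↦ ?_)
  · intro X Y f hf
    obtain ⟨h⟩ := hL.nonempty_mapFactorizationData f
    have := hf _ h.hi
    exact ⟨_, _, h.p, RetractArrow.ofRightLiftingProperty h.fac, h.hp⟩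
  · obtain ⟨_, _, g, h, hg⟩ := hf
    exact MorphismProperty.of_retract h (hP _ hg)

/-- Factor `f` in `W` through `I` and `P`. The right factor lies in `I.rlp ≤ W`, so two-out-of-three
puts the left factor in `I ⊓ W`, and the retract argument applies. -/
lemma rlp_inf_eq_rlp [W.HasTwoOutOfThreeProperty]
    (hI : MorphismProperty.HasFactorization I P) (hP : P ≤ I.rlp) (hW : I.rlp ≤ W) :
    (I ⊓ W).rlp ⊓ W = I.rlp := by
  refine le_antisymm ?_ (le_inf (MorphismProperty.antitone_rlp inf_le_left) hW)
  rintro X Y f ⟨hf, hfW⟩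
  obtain ⟨h⟩ := hI.nonempty_mapFactorizationData f
  have := hf _ ⟨h.hi, W.of_postcomp h.i h.p (hW _ (hP _ h.hp)) (by simpa using hfW)⟩
  exact MorphismProperty.of_retract (RetractArrow.ofRightLiftingProperty h.fac) (hP _ h.hp)

/-- The model structure with weak equivalences `W`, cofibrations `I` and fibrations the morphisms
with the right lifting property with respect to `I ⊓ W`. -/
@[reducible]
def modelCategoryOfFactorizations [HasFiniteLimits C] [HasFiniteColimits C]
    [W.HasTwoOutOfThreeProperty] [W.IsStableUnderRetracts] [I.IsStableUnderRetracts]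
    (hI : MorphismProperty.HasFactorization I P) (hP : P ≤ I.rlp) (hW : I.rlp ≤ W)
    (hIW : MorphismProperty.HasFactorization (I ⊓ W) (I ⊓ W).rlp) :
    ModelCategory C :=
  letI : CategoryWithFibrations C := ⟨(I ⊓ W).rlp⟩
  letI : CategoryWithCofibrations C := ⟨I⟩
  letI : CategoryWithWeakEquivalences C := ⟨W⟩
  { categoryWithFibrations := ⟨(I ⊓ W).rlp⟩
    categoryWithCofibrations := ⟨I⟩
    categoryWithWeakEquivalences := ⟨W⟩
    cm2 := ‹_›
    cm3a := ‹_›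
    cm3b := inferInstanceAs (I ⊓ W).rlp.IsStableUnderRetracts
    cm3c := ‹_›
    cm4a := fun i p hi hw hp ↦ (show (I ⊓ W).rlp p from hp.mem) _ ⟨hi.mem, hw.mem⟩
    cm4b := fun i p hi hp hw ↦ by
      have : I.rlp p := by
        rw [← rlp_inf_eq_rlp hI hP hW]
        exact ⟨hp.mem, hw.mem⟩
      exact this _ hi.mem
    cm5a := show MorphismProperty.HasFactorization (I ⊓ W) (I ⊓ W).rlp from hIW
    cm5b := by
      have h : P ≤ trivialFibrations C := by
        have := rlp_inf_eq_rlp hI hP hW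
        exact hP.trans this.ge
      exact ⟨fun f ↦ ⟨{ (hI.nonempty_mapFactorizationData f).some with
        hp := h _ (hI.nonempty_mapFactorizationData f).some.hp }⟩⟩ }

end Model

end CategoryTheory

/-! ## Chain complexes of vector spaces, elementwise -/

namespace ChainComplex

variable {k : Type u} [Field k] {K L : ChainComplex (ModuleCat.{u} k) ℕ}

/-- An element of degree `n` is a cycle if all the differentials vanish on it. -/
def IsCycle (K : ChainComplex (ModuleCat.{u} k) ℕ) {n : ℕ} (x : K.X n) : Prop :=
  ∀ m, K.d n m x = 0

lemma isCycle_iff {n : ℕ} (x : K.X n) :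
    K.IsCycle x ↔ K.d n ((ComplexShape.down ℕ).next n) x = 0 := by
  refine ⟨fun h ↦ h _, fun h m ↦ ?_⟩
  by_cases hm : (ComplexShape.down ℕ).Rel n m
  · obtain rfl := (ComplexShape.down ℕ).next_eq' hm
    exact h
  · rw [K.shape _ _ hm]
    rfl

lemma comm_apply (f : K ⟶ L) (i j : ℕ) (x : K.X i) : f.f j (K.d i j x) = L.d i j (f.f i x) := by
  rw [← ConcreteCategory.comp_apply, ← ConcreteCategory.comp_apply, f.comm]

lemma d_d_apply (K : ChainComplex (ModuleCat.{u} k) ℕ) (i j l : ℕ) (x : K.X i) :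
    K.d j l (K.d i j x) = 0 := by
  rw [← ConcreteCategory.comp_apply, K.d_comp_d]
  rfl

lemma isCycle_zero (K : ChainComplex (ModuleCat.{u} k) ℕ) (n : ℕ) : K.IsCycle (0 : K.X n) :=
  fun _ ↦ map_zero _

lemma IsCycle.map {n : ℕ} {x : K.X n} (hx : K.IsCycle x) (f : K ⟶ L) : L.IsCycle (f.f n x) :=
  fun m ↦ by rw [← comm_apply, hx m, map_zero]

lemma isCycle_of_degree_zero (x : K.X 0) : K.IsCycle x :=
  fun m ↦ by
    rw [K.shape _ _ (by simp)]
    rfl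

/-- Elements are maps from `k`, which turns the criterion up to refinements into one on elements.
Conversely, vector spaces are projective, so elementwise solutions can be chosen linearly and no
refinement is needed. -/
lemma mono_homologyMap_iff (f : K ⟶ L) (n : ℕ) :
    Mono (HomologicalComplex.homologyMap f n) ↔
      ∀ x : K.X n, K.IsCycle x → ∀ y : L.X (n + 1), f.f n x = L.d (n + 1) n y →
        ∃ x', K.d (n + 1) n x' = x := by
  rw [HomologicalComplex.mono_homologyMap_iff_up_to_refinements f (n + 1) n _ (by simp) rfl]
  constructor
  · intro h x hx y hxy
    obtain ⟨A', π, hπ, x₁, hx₁⟩ := h (A := ModuleCat.of k k)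
      (ModuleCat.ofHom (LinearMap.toSpanSingleton k _ x)) (by
        ext
        simpa using hx _)
      (ModuleCat.ofHom (LinearMap.toSpanSingleton k _ y)) (by
        ext
        simpa using hxy)
    obtain ⟨a, ha⟩ := (ModuleCat.epi_iff_surjective π).1 hπ (1 : k)
    refine ⟨x₁ a, ?_⟩
    rw [← ConcreteCategory.comp_apply, ← hx₁, ConcreteCategory.comp_apply, ha]
    simp
  · intro h A x hx y hxy
    have h₁ (a : A) : ∃ b, K.d (n + 1) n b = x a := by
      refine h _ ((isCycle_iff _).2 ?_) (y a) ?_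
      · rw [← ConcreteCategory.comp_apply, hx]
        rfl
      · rw [← ConcreteCategory.comp_apply, hxy]
        rfl
    have : Module.Projective k A := Module.Projective.of_free
    obtain ⟨l, hl⟩ := Module.projective_lifting_property
      (K.d (n + 1) n).hom.rangeRestrict (x.hom.codRestrict (LinearMap.range (K.d (n + 1) n).hom) h₁)
      (LinearMap.surjective_rangeRestrict _)
    refine ⟨A, 𝟙 A, inferInstance, ModuleCat.ofHom l, ?_⟩
    ext a
    exact (congrArg Subtype.val (LinearMap.congr_fun hl a)).symm

lemma epi_homologyMap_iff (f : K ⟶ L) (n : ℕ) :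
    Epi (HomologicalComplex.homologyMap f n) ↔
      ∀ y : L.X n, L.IsCycle y → ∃ (x : K.X n) (y' : L.X (n + 1)), K.IsCycle x ∧
        y = f.f n x + L.d (n + 1) n y' := by
  rw [HomologicalComplex.epi_homologyMap_iff_up_to_refinements f (n + 1) n _ (by simp) rfl]
  constructor
  · intro h y hy
    obtain ⟨A', π, hπ, x, hx, y₁, hy₁⟩ := h (A := ModuleCat.of k k)
      (ModuleCat.ofHom (LinearMap.toSpanSingleton k _ y)) (by
        ext
        simpa using hy _)
    obtain ⟨a, ha⟩ := (ModuleCat.epi_iff_surjective π).1 hπ (1 : k)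
    refine ⟨x a, y₁ a, (isCycle_iff _).2 ?_, ?_⟩
    · rw [← ConcreteCategory.comp_apply, hx]
      rfl
    · have := ConcreteCategory.congr_hom hy₁ a
      rw [ConcreteCategory.comp_apply, ha] at this
      simpa using this
  · intro h A y hy
    let p := (((f.f n).hom.comp (LinearMap.ker
      (K.d n ((ComplexShape.down ℕ).next n)).hom).subtype).coprod
      (L.d (n + 1) n).hom)
    have h₁ (a : A) : y a ∈ LinearMap.range p := by
      obtain ⟨x, y', hx, hy'⟩ := h (y a) ((isCycle_iff _).2 (by
        rw [← ConcreteCategory.comp_apply, hy]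
        rfl))
      exact ⟨(⟨x, hx _⟩, y'), hy'.symm⟩
    have : Module.Projective k A := Module.Projective.of_free
    obtain ⟨l, hl⟩ := Module.projective_lifting_property
      p.rangeRestrict (y.hom.codRestrict (LinearMap.range p) h₁)
      (LinearMap.surjective_rangeRestrict _)
    refine ⟨A, 𝟙 A, inferInstance, ModuleCat.ofHom ((Submodule.subtype _).comp
      ((LinearMap.fst _ _ _).comp l)), ?_, ModuleCat.ofHom ((LinearMap.snd _ _ _).comp l), ?_⟩
    · ext a
      exact (l a).1.2
    · ext a
      exact (congrArg Subtype.val (LinearMap.congr_fun hl a)).symm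

lemma quasiIsoAt_iff (f : K ⟶ L) (n : ℕ) :
    QuasiIsoAt f n ↔
      (∀ x : K.X n, K.IsCycle x → ∀ y : L.X (n + 1), f.f n x = L.d (n + 1) n y →
        ∃ x', K.d (n + 1) n x' = x) ∧
      ∀ y : L.X n, L.IsCycle y → ∃ (x : K.X n) (y' : L.X (n + 1)), K.IsCycle x ∧
        y = f.f n x + L.d (n + 1) n y' := by
  rw [quasiIsoAt_iff_isIso_homologyMap, ← mono_homologyMap_iff, ← epi_homologyMap_iff]
  exact ⟨fun _ ↦ ⟨inferInstance, inferInstance⟩, fun ⟨_, _⟩ ↦ isIso_of_mono_of_epi _⟩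

/-- The elements whose differentials are in the image of `f`. -/
def relCycles (f : K ⟶ L) (n : ℕ) : Submodule k (L.X n) :=
  ⨅ m, (LinearMap.range (f.f m).hom).comap (L.d n m).hom

/-- The sums of an element of the image of `f` and of a boundary. -/
def relBoundaries (f : K ⟶ L) (n : ℕ) : Submodule k (L.X n) :=
  LinearMap.range (f.f n).hom ⊔ LinearMap.range (L.d (n + 1) n).hom

lemma mem_relCycles {f : K ⟶ L} {n : ℕ} {y : L.X n} :
    y ∈ relCycles f n ↔ ∀ m, ∃ x, f.f m x = L.d n m y := by
  simp only [relCycles, Submodule.mem_iInf]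
  rfl

lemma mem_relCycles_succ {f : K ⟶ L} {n : ℕ} {y : L.X (n + 1)} :
    y ∈ relCycles f (n + 1) ↔ ∃ x, f.f n x = L.d (n + 1) n y := by
  rw [mem_relCycles]
  refine ⟨fun h ↦ h n, fun h m ↦ ?_⟩
  by_cases hm : m = n
  · subst hm
    exact h
  · refine ⟨0, ?_⟩
    rw [L.shape _ _ (by simpa using hm), map_zero]
    rfl

lemma mem_relBoundaries {f : K ⟶ L} {n : ℕ} {y : L.X n} :
    y ∈ relBoundaries f n ↔ ∃ x y', f.f n x + L.d (n + 1) n y' = y := by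
  rw [relBoundaries, Submodule.mem_sup]
  constructor
  · rintro ⟨_, ⟨x, rfl⟩, _, ⟨y', rfl⟩, h⟩
    exact ⟨x, y', h⟩
  · rintro ⟨x, y', h⟩
    exact ⟨_, ⟨x, rfl⟩, _, ⟨y', rfl⟩, h⟩

lemma relBoundaries_le_relCycles (f : K ⟶ L) (n : ℕ) : relBoundaries f n ≤ relCycles f n := by
  intro y hy
  obtain ⟨x, y', rfl⟩ := mem_relBoundaries.1 hy
  refine mem_relCycles.2 (fun m ↦ ⟨K.d n m x, ?_⟩)
  rw [map_add, d_d_apply, add_zero, comm_apply]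

lemma relCycles_zero (f : K ⟶ L) : relCycles f 0 = ⊤ := by
  refine eq_top_iff.2 (fun y _ ↦ mem_relCycles.2 (fun m ↦ ⟨0, ?_⟩))
  rw [map_zero, isCycle_of_degree_zero y m]

/-- For injective `f`, the two submodules are the preimages in `L` of the cycles and boundaries of
the cokernel. The right side says that the cokernel is acyclic, and the proof is the long exact
sequence on elements. -/
lemma quasiIso_iff_relCycles_le {f : K ⟶ L} (hf : ∀ n, Function.Injective (f.f n)) :
    QuasiIso f ↔ ∀ n, relCycles f n ≤ relBoundaries f n := by
  constructor
  · intro h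
    rintro (_ | n) y hy
    · obtain ⟨x, y', -, rfl⟩ := ((quasiIsoAt_iff f 0).1 inferInstance).2 y
        (isCycle_of_degree_zero y)
      exact mem_relBoundaries.2 ⟨_, _, rfl⟩
    · obtain ⟨x, hx⟩ := mem_relCycles_succ.1 hy
      have hx' : K.IsCycle x := fun m ↦ hf m (by rw [comm_apply, hx, d_d_apply, map_zero])
      obtain ⟨z, rfl⟩ := ((quasiIsoAt_iff f n).1 inferInstance).1 x hx' y hx
      have hy' : L.IsCycle (y - f.f _ z) := by
        rw [isCycle_iff, ChainComplex.next_nat_succ, map_sub, ← comm_apply, hx, sub_self]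
      obtain ⟨x', y', -, h'⟩ := ((quasiIsoAt_iff f (n + 1)).1 inferInstance).2 _ hy'
      refine mem_relBoundaries.2 ⟨z + x', y', ?_⟩
      rw [map_add, add_assoc, ← h', add_sub_cancel]
  · intro h
    refine ⟨fun n ↦ (quasiIsoAt_iff f n).2 ⟨fun x hx y hxy ↦ ?_, fun y hy ↦ ?_⟩⟩
    · obtain ⟨x', y', rfl⟩ := mem_relBoundaries.1 (h _ (mem_relCycles_succ.2 ⟨x, hxy⟩))
      refine ⟨x', hf n ?_⟩
      rw [hxy, map_add, d_d_apply, add_zero, comm_apply]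
    · obtain ⟨x', y', rfl⟩ := mem_relBoundaries.1
        (h n (mem_relCycles.2 (fun m ↦ ⟨0, by rw [map_zero, hy m]⟩)))
      refine ⟨x', y', fun m ↦ hf m ?_, rfl⟩
      have := hy m
      rwa [map_add, d_d_apply, add_zero, ← comm_apply, ← map_zero (f.f m).hom] at this

/-! ### Lifting injective quasi-isomorphisms against maps surjective in positive degrees -/

section Lifting

variable {A B X Y : ChainComplex (ModuleCat.{u} k) ℕ} {i : A ⟶ B} {p : X ⟶ Y}

lemma exists_isCompl_relCycles (i : A ⟶ B) (n : ℕ) :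
    ∃ W : Submodule k (B.X n), IsCompl (relCycles i n) W :=
  Submodule.exists_isCompl _

/-- A complement of the relative cycles. -/
def relCompl (i : A ⟶ B) (n : ℕ) : Submodule k (B.X n) := (exists_isCompl_relCycles i n).choose

lemma isCompl_relCompl (i : A ⟶ B) (n : ℕ) : IsCompl (relCycles i n) (relCompl i n) :=
  (exists_isCompl_relCycles i n).choose_spec

lemma eq_zero_of_mem_relCompl {n : ℕ} {w : B.X n} (hw : w ∈ relCompl i n)
    (hw' : w ∈ relCycles i n) : w = 0 := by
  simpa using (isCompl_relCompl i n).disjoint.le_bot ⟨hw', hw⟩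

/-- The decomposition map of the target of a trivial cofibration. -/
def decomp (i : A ⟶ B) (n : ℕ) :
    A.X n × relCompl i (n + 1) × relCompl i n →ₗ[k] B.X n :=
  (i.f n).hom.coprod (((B.d (n + 1) n).hom.comp (Submodule.subtype _)).coprod
    (Submodule.subtype _))

lemma decomp_apply (i : A ⟶ B) (n : ℕ) (a : A.X n) (w' : relCompl i (n + 1))
    (w : relCompl i n) :
    decomp i n (a, w', w) = i.f n a + (B.d (n + 1) n w'.1 + w.1) := rfl

/-- This exhibits `B` degreewise as `A` plus disks on the complements of the relative cycles. In a
vanishing sum `i a + d w' + w`, the term `w` is a relative cycle, hence zero; then so is `w'`, and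
finally `a`. -/
lemma bijective_decomp (hi : ∀ n, Function.Injective (i.f n))
    (hi' : ∀ n, relCycles i n ≤ relBoundaries i n) (n : ℕ) :
    Function.Bijective (decomp i n) := by
  constructor
  · rw [← LinearMap.ker_eq_bot, LinearMap.ker_eq_bot']
    rintro ⟨a, w', w⟩ h
    rw [decomp_apply] at h
    obtain rfl : w = 0 := by
      ext
      refine eq_zero_of_mem_relCompl w.2 (relBoundaries_le_relCycles i n
        (mem_relBoundaries.2 ⟨-a, -w'.1, ?_⟩))
      rw [map_neg, map_neg]
      rw [← sub_eq_zero, ← neg_eq_zero, ← h]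
      abel
    have h' : i.f n (-a) = B.d (n + 1) n w'.1 := by
      rw [map_neg, neg_eq_iff_add_eq_zero, ← h]
      simp
    obtain rfl : w' = 0 := by
      ext
      exact eq_zero_of_mem_relCompl w'.2 (mem_relCycles_succ.2 ⟨_, h'⟩)
    obtain rfl : a = 0 := hi n (by simpa using h)
    rfl
  · intro b
    obtain ⟨z, hz, w, hw, rfl⟩ := Submodule.mem_sup.1
      ((isCompl_relCompl i n).sup_eq_top.ge (Submodule.mem_top (x := b)))
    obtain ⟨a, b', rfl⟩ := mem_relBoundaries.1 (hi' n hz)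
    obtain ⟨z', hz', w', hw', rfl⟩ := Submodule.mem_sup.1
      ((isCompl_relCompl i (n + 1)).sup_eq_top.ge (Submodule.mem_top (x := b')))
    obtain ⟨a', ha'⟩ := mem_relCycles_succ.1 hz'
    refine ⟨(a + a', ⟨w', hw'⟩, ⟨w, hw⟩), ?_⟩
    rw [decomp_apply, map_add, map_add, ha']
    abel

/-- Use `t` on the summand `A`, any linear choice of preimages on the complement `relCompl`, and the
differential of that choice on the remaining summand. -/
lemma exists_lift_of_injective_of_quasiIso (hi : ∀ n, Function.Injective (i.f n)) [QuasiIso i]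
    (hp : ∀ n, 0 < n → Function.Surjective (p.f n)) {t : A ⟶ X} {g : B ⟶ Y}
    (sq : t ≫ p = i ≫ g) : ∃ l : B ⟶ X, i ≫ l = t ∧ l ≫ p = g := by
  have hi' := (quasiIso_iff_relCycles_le hi).1 inferInstance
  have hu (n : ℕ) : ∃ u : Y.X n →ₗ[k] X.X n, 0 < n → ∀ y, p.f n (u y) = y := by
    by_cases hn : 0 < n
    · obtain ⟨u, hu⟩ := (p.f n).hom.exists_rightInverse_of_surjective
        (LinearMap.range_eq_top.2 (hp n hn))
      exact ⟨u, fun _ ↦ LinearMap.congr_fun hu⟩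
    · exact ⟨0, fun h ↦ (hn h).elim⟩
  choose u hu using hu
  -- In degree `0` every element is a relative cycle, so the complement is zero and surjectivity of
  -- `p` is not needed there.
  have hu₀ (n : ℕ) (w : relCompl i n) : p.f n (u n (g.f n w.1)) = g.f n w.1 := by
    obtain _ | n := n
    · obtain rfl : w = 0 := by
        ext
        exact eq_zero_of_mem_relCompl w.2 (relCycles_zero i ▸ Submodule.mem_top)
      simp
    · exact hu _ n.succ_pos _
  let e (n : ℕ) := LinearEquiv.ofBijective _ (bijective_decomp hi hi' n)
  let l (n : ℕ) : B.X n →ₗ[k] X.X n :=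
    ((t.f n).hom.coprod (((X.d (n + 1) n).hom.comp
      ((u (n + 1)).comp ((g.f (n + 1)).hom.comp (Submodule.subtype _)))).coprod
        ((u n).comp ((g.f n).hom.comp (Submodule.subtype _))))).comp (e n).symm.toLinearMap
  have hl (n : ℕ) (a : A.X n) (w' : relCompl i (n + 1)) (w : relCompl i n) :
      l n (i.f n a + (B.d (n + 1) n w'.1 + w.1)) =
        t.f n a + (X.d (n + 1) n (u (n + 1) (g.f (n + 1) w'.1)) + u n (g.f n w.1)) := by
    have : (e n).symm (i.f n a + (B.d (n + 1) n w'.1 + w.1)) = (a, w', w) :=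
      (e n).symm_apply_apply (a, w', w)
    simp only [l, LinearMap.comp_apply, LinearEquiv.coe_coe, this]
    rfl
  have hd (n : ℕ) (b : B.X n) : ∃ (a : A.X n) (w' : relCompl i (n + 1)) (w : relCompl i n),
      b = i.f n a + (B.d (n + 1) n w'.1 + w.1) := by
    obtain ⟨⟨a, w', w⟩, rfl⟩ := (bijective_decomp hi hi' n).2 b
    exact ⟨a, w', w, rfl⟩
  have sq' (n : ℕ) (a : A.X n) : p.f n (t.f n a) = g.f n (i.f n a) := by
    rw [← ConcreteCategory.comp_apply, ← ConcreteCategory.comp_apply, ← HomologicalComplex.comp_f,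
      sq, HomologicalComplex.comp_f]
  refine ⟨{ f := fun n ↦ ModuleCat.ofHom (l n), comm' := ?_ }, ?_, ?_⟩
  · rintro _ n rfl
    ext b
    obtain ⟨a, w', w, rfl⟩ := hd _ b
    have h₁ : B.d (n + 1) n (i.f _ a + (B.d _ _ w'.1 + w.1)) =
        i.f n (A.d _ _ a) + (B.d (n + 1) n w.1 + (0 : relCompl i n).1) := by
      rw [map_add, map_add, d_d_apply, comm_apply, zero_add, ZeroMemClass.coe_zero, add_zero]
    change X.d (n + 1) n (l (n + 1) _) = l n (B.d (n + 1) n _)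
    rw [h₁, hl, hl, map_add, map_add, d_d_apply, comm_apply]
    simp
  · ext n a
    change l n (i.f n a) = _
    simpa using hl n a 0 0
  · ext n b
    obtain ⟨a, w', w, rfl⟩ := hd _ b
    change p.f n (l n _) = _
    rw [hl, map_add, map_add, map_add, map_add, sq', hu₀, comm_apply, hu₀, ← comm_apply]

end Lifting

end ChainComplex

/-! ## Exactness properties of finite-type chain complexes -/

namespace FinTypeCh

open Limits ObjectProperty

section Abelian

variable (k : Type u) [Field k]

instance : (finiteType k).IsClosedUnderSubobjects where
  prop_of_mono {K L} f _ hL n := by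
    have := hL n
    have : Mono (f.f n) := inferInstance
    exact Module.Finite.of_injective (f.f n).hom ((ModuleCat.mono_iff_injective _).1 this)

instance : (finiteType k).IsClosedUnderQuotients where
  prop_of_epi {K L} f _ hK n := by
    have := hK n
    have : Epi (f.f n) := inferInstance
    exact Module.Finite.of_surjective (f.f n).hom ((ModuleCat.epi_iff_surjective _).1 this)

instance : (finiteType k).ContainsZero where
  exists_zero := ⟨_, Limits.isZero_zero _, finiteType_zero k⟩

instance : (finiteType k).IsClosedUnderFiniteProducts where
  isClosedUnderLimitsOfShape J _ := ⟨by
    rintro K ⟨p⟩ n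
    have (j : J) : Module.Finite k ((p.diag.obj ⟨j⟩).X n) := p.prop_diag_obj ⟨j⟩ n
    refine Module.Finite.of_injective (LinearMap.pi (fun j : J ↦ ((p.π.app ⟨j⟩).f n).hom)) ?_
    rw [← LinearMap.ker_eq_bot, LinearMap.ker_eq_bot']
    intro x hx
    -- An element of the limit is a map from `k`, hence is detected by the projections.
    have h : ModuleCat.ofHom (LinearMap.toSpanSingleton k (K.X n) x) = 0 := by
      refine (isLimitOfPreserves (HomologicalComplex.eval _ _ n) p.isLimit).hom_ext (fun ⟨j⟩ ↦ ?_)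
      refine Eq.trans ?_ zero_comp.symm
      ext
      change (p.π.app ⟨j⟩).f n ((1 : k) • x) = 0
      rw [one_smul]
      exact congrFun hx j
    simpa using congrArg (fun f ↦ f.hom (1 : k)) h⟩

instance : PreservesFiniteLimits (finiteType k).ι :=
  (((finiteType k).ι.preservesFiniteLimits_tfae).out 2 3).1
    (fun _ _ f ↦ (finiteType k).preservesKernels_ι f)

/-- The evaluation functor in degree `n`. -/
abbrev eval (n : ℕ) : FinTypeCh k ⥤ ModuleCat.{u} k :=
  (finiteType k).ι ⋙ HomologicalComplex.eval _ _ n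

end Abelian

/-! ### Tensor products of families of linear maps that need not commute with differentials -/

section Tensor

variable {k : Type u} [Field k] {K K' K'' L L' : ChainComplex (ModuleCat.{u} k) ℕ}

/-- The tensor product of families of linear maps. -/
def gradedTensor (r : ∀ i, K.X i ⟶ K'.X i) (s : ∀ i, L.X i ⟶ L'.X i) (n : ℕ) :
    (K ⊗ L).X n ⟶ (K' ⊗ L').X n :=
  HomologicalComplex.mapBifunctorDesc (fun i j h ↦
    r i ▷ L.X j ≫ K'.X i ◁ s j ≫ HomologicalComplex.ιTensorObj K' L' i j n h)

lemma tensor_hom_ext {n : ℕ} {V : ModuleCat.{u} k} {f g : (K ⊗ L).X n ⟶ V}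
    (h : ∀ i j (hij : i + j = n), HomologicalComplex.ιTensorObj K L i j n hij ≫ f =
      HomologicalComplex.ιTensorObj K L i j n hij ≫ g) : f = g :=
  HomologicalComplex.mapBifunctor.hom_ext h

lemma ι_gradedTensor (r : ∀ i, K.X i ⟶ K'.X i) (s : ∀ i, L.X i ⟶ L'.X i) (n i j : ℕ)
    (h : i + j = n) :
    HomologicalComplex.ιTensorObj K L i j n h ≫ gradedTensor r s n =
      r i ▷ L.X j ≫ K'.X i ◁ s j ≫ HomologicalComplex.ιTensorObj K' L' i j n h :=
  HomologicalComplex.ι_mapBifunctorDesc ..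

lemma ι_gradedTensor_assoc (r : ∀ i, K.X i ⟶ K'.X i) (s : ∀ i, L.X i ⟶ L'.X i) (n i j : ℕ)
    (h : i + j = n) {V : ModuleCat.{u} k} (f : (K' ⊗ L').X n ⟶ V) :
    HomologicalComplex.ιTensorObj K L i j n h ≫ gradedTensor r s n ≫ f =
      r i ▷ L.X j ≫ K'.X i ◁ s j ≫ HomologicalComplex.ιTensorObj K' L' i j n h ≫ f := by
  rw [← Category.assoc, ι_gradedTensor, Category.assoc, Category.assoc]

lemma tensorHom_f (f : K ⟶ K') (g : L ⟶ L') (n : ℕ) :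
    (f ⊗ₘ g).f n = gradedTensor f.f g.f n := by
  refine tensor_hom_ext (fun i j h ↦ ?_)
  rw [ι_gradedTensor]
  exact HomologicalComplex.ι_mapBifunctorMap ..

lemma whiskerRight_f (f : K ⟶ K') (L : ChainComplex (ModuleCat.{u} k) ℕ) (n : ℕ) :
    (f ▷ L).f n = gradedTensor f.f (fun _ ↦ 𝟙 (L.X _)) n := by
  rw [← tensorHom_id, tensorHom_f]
  rfl

lemma whiskerLeft_f (K : ChainComplex (ModuleCat.{u} k) ℕ) (g : L ⟶ L') (n : ℕ) :
    (K ◁ g).f n = gradedTensor (fun _ ↦ 𝟙 (K.X _)) g.f n := by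
  rw [← id_tensorHom, tensorHom_f]
  rfl

lemma gradedTensor_comp (r : ∀ i, K.X i ⟶ K'.X i) (r' : ∀ i, K'.X i ⟶ K''.X i) (n : ℕ) :
    gradedTensor r (fun _ ↦ 𝟙 (L.X _)) n ≫ gradedTensor r' (fun _ ↦ 𝟙 (L.X _)) n =
      gradedTensor (fun i ↦ r i ≫ r' i) (fun _ ↦ 𝟙 (L.X _)) n := by
  refine tensor_hom_ext (fun i j h ↦ ?_)
  simp [ι_gradedTensor, ι_gradedTensor_assoc]

lemma gradedTensor_id (n : ℕ) :
    gradedTensor (fun _ ↦ 𝟙 (K.X _)) (fun _ ↦ 𝟙 (L.X _)) n = 𝟙 _ := by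
  refine tensor_hom_ext (fun i j h ↦ ?_)
  simp only [ι_gradedTensor, id_whiskerRight, whiskerLeft_id, Category.id_comp]
  exact (Category.comp_id _).symm

lemma gradedTensor_add (r r' : ∀ i, K.X i ⟶ K'.X i) (n : ℕ) :
    gradedTensor (fun i ↦ r i + r' i) (fun _ ↦ 𝟙 (L.X _)) n =
      gradedTensor r (fun _ ↦ 𝟙 (L.X _)) n + gradedTensor r' (fun _ ↦ 𝟙 (L.X _)) n := by
  refine tensor_hom_ext (fun i j h ↦ ?_)
  simp [ι_gradedTensor, Preadditive.comp_add]

lemma isIso_gradedTensor (r : ∀ i, K.X i ⟶ K'.X i) (s : ∀ i, L.X i ⟶ L'.X i) (n : ℕ)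
    (h : ∀ i j, i + j = n → IsIso (r i ▷ L.X j ≫ K'.X i ◁ s j)) :
    IsIso (gradedTensor r s n) := by
  let inv : (K' ⊗ L').X n ⟶ (K ⊗ L).X n := HomologicalComplex.mapBifunctorDesc (fun i j hij ↦
    have := h i j hij
    CategoryTheory.inv (r i ▷ L.X j ≫ K'.X i ◁ s j) ≫ HomologicalComplex.ιTensorObj K L i j n hij)
  have hinv (i j : ℕ) (hij : i + j = n) (_ : IsIso (r i ▷ L.X j ≫ K'.X i ◁ s j)) :
      HomologicalComplex.ιTensorObj K' L' i j n hij ≫ inv =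
        CategoryTheory.inv (r i ▷ L.X j ≫ K'.X i ◁ s j) ≫
          HomologicalComplex.ιTensorObj K L i j n hij :=
    HomologicalComplex.ι_mapBifunctorDesc ..
  refine ⟨inv, tensor_hom_ext (fun i j hij ↦ ?_), tensor_hom_ext (fun i j hij ↦ ?_)⟩
  · have := h i j hij
    rw [ι_gradedTensor_assoc, hinv _ _ _ this, ← Category.assoc, IsIso.hom_inv_id_assoc]
    exact (Category.comp_id _).symm
  · have := h i j hij
    rw [← Category.assoc, hinv _ _ _ this, Category.assoc, ι_gradedTensor,
      ← Category.assoc (r i ▷ _),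
      IsIso.inv_hom_id_assoc]
    exact (Category.comp_id _).symm

end Tensor

/-! ### Exactness of tensoring with a fixed complex -/

section TensorFunctor

variable {k : Type u} [Field k] (C : FinTypeCh k)

instance : (tensorRight C).Additive where
  map_add {K L f g} := by
    apply ObjectProperty.hom_ext
    ext n : 1
    change ((f.hom + g.hom) ▷ C.obj).f n = (f.hom ▷ C.obj).f n + (g.hom ▷ C.obj).f n
    rw [whiskerRight_f, whiskerRight_f, whiskerRight_f, ← gradedTensor_add]
    rfl


variable (k) in
instance : PreservesFiniteColimits (finiteType k).ι :=
  (((finiteType k).ι.preservesFiniteColimits_tfae).out 2 3).1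
    (fun _ _ f ↦ (finiteType k).preservesCokernels_ι f)

variable {C} in
/-- Tensoring on the right preserves degreewise split short exact sequences. -/
def gradedTensorSplitting {S : ShortComplex (ChainComplex (ModuleCat.{u} k) ℕ)}
    (σ : ∀ i, (S.map (HomologicalComplex.eval _ _ i)).Splitting)
    (L : ChainComplex (ModuleCat.{u} k) ℕ) (n : ℕ) (w : S.f ▷ L ≫ S.g ▷ L = 0) :
    ((ShortComplex.mk (S.f ▷ L) (S.g ▷ L) w).map (HomologicalComplex.eval _ _ n)).Splitting where
  r := gradedTensor (fun i ↦ (σ i).r) (fun _ ↦ 𝟙 (L.X _)) n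
  s := gradedTensor (fun i ↦ (σ i).s) (fun _ ↦ 𝟙 (L.X _)) n
  f_r := by
    refine (congrArg (· ≫ _) (whiskerRight_f S.f L n)).trans ((gradedTensor_comp _ _ _).trans
      (Eq.trans ?_ (gradedTensor_id n)))
    exact congrArg (fun r ↦ gradedTensor r (fun _ ↦ 𝟙 (L.X _)) n) (funext fun i ↦ (σ i).f_r)
  s_g := by
    refine (congrArg (_ ≫ ·) (whiskerRight_f S.g L n)).trans ((gradedTensor_comp _ _ _).trans
      (Eq.trans ?_ (gradedTensor_id n)))
    exact congrArg (fun r ↦ gradedTensor r (fun _ ↦ 𝟙 (L.X _)) n) (funext fun i ↦ (σ i).s_g)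
  id := by
    refine (congrArg₂ (· + ·) ((congrArg (_ ≫ ·) (whiskerRight_f S.f L n)).trans
      (gradedTensor_comp _ _ _)) ((congrArg (· ≫ _) (whiskerRight_f S.g L n)).trans
      (gradedTensor_comp _ _ _))).trans ((gradedTensor_add _ _ _).symm.trans
      (Eq.trans ?_ (gradedTensor_id n)))
    exact congrArg (fun r ↦ gradedTensor r (fun _ ↦ 𝟙 (L.X _)) n) (funext fun i ↦ (σ i).id)

/-- A short exact sequence of complexes over a field splits in each degree. The splittings are not
chain maps, but `gradedTensor` still tensors them with `C`, so the tensored sequence is split in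
each degree. -/
instance : PreservesFiniteLimits (tensorRight C) := by
  refine (((tensorRight C).preservesFiniteLimits_tfae).out 0 3).1 (fun S hS ↦ ?_)
  have hS' := hS.map_of_exact (finiteType k).ι
  have σ (i : ℕ) : ((S.map (finiteType k).ι).map (HomologicalComplex.eval _ _ i)).Splitting :=
    have := hS'.map_of_exact (HomologicalComplex.eval _ _ i)
    have : Module.Projective k ((S.map (finiteType k).ι).map (HomologicalComplex.eval _ _ i)).X₃ :=
      Module.Projective.of_free
    (hS'.map_of_exact (HomologicalComplex.eval _ _ i)).splittingOfProjective
  have h : ((S.map (tensorRight C)).map (finiteType k).ι).ShortExact :=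
    HomologicalComplex.shortExact_of_degreewise_shortExact _
      (fun n ↦ (gradedTensorSplitting σ C.obj n _).shortExact)
  refine ⟨(ShortComplex.exact_map_iff_of_faithful _ (finiteType k).ι).1 h.exact, ?_⟩
  have := h.mono_f
  exact (finiteType k).ι.mono_of_mono_map this

end TensorFunctor

end FinTypeCh

namespace FinTypeCh

open Limits

variable {k : Type u} [Field k]

/-! ## Tensor products in low degrees -/

section

lemma isIso_whiskerRight_f {K K' : FinTypeCh k} (f : K ⟶ K') (L : FinTypeCh k) (n : ℕ)
    (h : ∀ i ≤ n, IsIso (f.hom.f i)) : IsIso ((f ▷ L).hom.f n) := by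
  have : IsIso ((f.hom ▷ L.obj).f n) := by
    rw [whiskerRight_f]
    refine isIso_gradedTensor _ _ _ (fun i j hij ↦ ?_)
    have := h i (by lia)
    infer_instance
  exact this

lemma isIso_whiskerLeft_f (K : FinTypeCh k) {L L' : FinTypeCh k} (g : L ⟶ L') (n : ℕ)
    (h : ∀ i j, i + j = n → IsZero (K.obj.X i) ∨ IsIso (g.hom.f j)) :
    IsIso ((K ◁ g).hom.f n) := by
  have : IsIso ((K.obj ◁ g.hom).f n) := by
    rw [whiskerLeft_f]
    refine isIso_gradedTensor _ _ _ (fun i j hij ↦ ?_)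
    obtain h | h := h i j hij
    · have h₁ (V : ModuleCat.{u} k) : IsZero (K.obj.X i ⊗ V) :=
        (tensorRight V).map_isZero h
      rw [id_whiskerRight, Category.id_comp]
      exact ⟨0, (h₁ _).eq_of_src _ _, (h₁ _).eq_of_src _ _⟩
    · infer_instance
  exact this

variable {C : FinTypeCh k} [ComonObj C]

open scoped ComonObj

/-- In degree `0` the coaugmentation makes the counit surjective between lines; in degree `1` both
sides vanish. -/
lemma isIso_counit_f (η : Coaugmentation C) (hC : IsOneConnected C) (n : ℕ) (hn : n ≤ 1) :
    IsIso ((ε[C] : C ⟶ 𝟙_ _).hom.f n) := by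
  obtain rfl | rfl : n = 0 ∨ n = 1 := by lia
  · have hsurj : Function.Surjective ((ε[C] : C ⟶ 𝟙_ _).hom.f 0) := by
      intro x
      refine ⟨η.η.hom.f 0 x, ?_⟩
      have := congrArg (fun f ↦ f.hom.f 0 x) η.η_counit
      exact this
    have e : ((𝟙_ (FinTypeCh k)).obj.X 0 : ModuleCat.{u} k) ≅ ModuleCat.of k k :=
      HomologicalComplex.singleObjXSelf _ 0 _
    have h₁ : Module.finrank k (C.obj.X 0) = Module.finrank k ((𝟙_ (FinTypeCh k)).obj.X 0) := by
      rw [hC.finrank_zero, e.toLinearEquiv.finrank_eq]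
      exact (Module.finrank_self k).symm
    have := C.property 0
    have := (𝟙_ (FinTypeCh k)).property 0
    have hinj := (LinearMap.injective_iff_surjective_of_finrank_eq_finrank h₁).2 hsurj
    exact (ConcreteCategory.isIso_iff_bijective _).2 ⟨hinj, hsurj⟩
  · have := hC.subsingleton_one
    have h₁ : IsZero (C.obj.X 1) := ModuleCat.isZero_of_subsingleton _
    have h₂ : IsZero ((𝟙_ (FinTypeCh k)).obj.X 1) :=
      HomologicalComplex.isZero_single_obj_X _ _ _ _ (by simp)
    exact ⟨0, h₁.eq_of_src _ _, h₂.eq_of_src _ _⟩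

/-- The counit `X ⊗ C ⟶ X`. -/
def counit (C : FinTypeCh k) [ComonObj C] (K : FinTypeCh k) : K ⊗ C ⟶ K := K ◁ ε[C] ≫ (ρ_ K).hom

/-- In total degree `n ≤ m + 1`, a summand whose first factor has degree at least `m` involves `C`
only in degrees `0` and `1`, where the counit is an isomorphism; the other summands are zero. -/
lemma isIso_counit_tensor_f (η : Coaugmentation C) (hC : IsOneConnected C) (K : FinTypeCh k) (m : ℕ)
    (hK : ∀ i < m, IsZero (K.obj.X i)) (n : ℕ) (hn : n ≤ m + 1) :
    IsIso ((counit C K).hom.f n) := by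
  have h₁ : IsIso ((K ◁ (ε[C] : C ⟶ _)).hom.f n) := by
    refine isIso_whiskerLeft_f K _ n (fun i j hij ↦ ?_)
    by_cases hi : i < m
    · exact Or.inl (hK i hi)
    · exact Or.inr (isIso_counit_f η hC j (by lia))
  have h₂ : IsIso ((ρ_ K).hom.hom.f n) :=
    inferInstanceAs (IsIso ((eval k n).map (ρ_ K).hom))
  exact IsIso.comp_isIso' h₁ h₂

end

/-! ## Disks and spheres -/

section

lemma dNext_eq_zero {K L : ChainComplex (ModuleCat.{u} k) ℕ} (i : ℕ)
    (f : ∀ i j, K.X i ⟶ L.X j) (h : K.d i ((ComplexShape.down ℕ).next i) = 0) :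
    dNext i f = 0 := by
  rw [dNext_eq_dFrom_fromNext, HomologicalComplex.dFrom, h, zero_comp]

/-- The homotopy between the identity of a disk and zero. -/
def diskHomotopy (m : ℕ) : Homotopy (𝟙 (disk k m).obj) 0 where
  hom i j := if h : i = m ∧ j = m + 1 then
    eqToHom (by rw [h.1]) ≫ (HomologicalComplex.doubleXIso₁ (𝟙 (ModuleCat.of k k))
        (down_rel m) (by simp)).hom ≫ (HomologicalComplex.doubleXIso₀ (𝟙 (ModuleCat.of k k))
        (down_rel m)).inv ≫ eqToHom (by rw [h.2]) else 0
  zero i j h := dif_neg (fun ⟨hi, hj⟩ ↦ h (by subst hi hj; simp))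
  comm i := by
    by_cases h₀ : i = m + 1
    · subst h₀
      rw [dNext_eq _ (down_rel m), prevD_eq _ (down_rel (m + 1)), dif_pos ⟨rfl, rfl⟩,
        dif_neg (by simp), zero_comp]
      erw [HomologicalComplex.double_d _ (down_rel m) (by simp)]
      simp
    by_cases h₁ : i = m
    · subst h₁
      rw [prevD_eq _ (down_rel i), dif_pos ⟨rfl, rfl⟩]
      rw [dNext_eq_zero _ _ (HomologicalComplex.double_d_eq_zero₀ _ _ _ _ h₀)]
      erw [HomologicalComplex.double_d _ (down_rel i) (by simp)]
      simp
    · exact (HomologicalComplex.isZero_double_X (𝟙 (ModuleCat.of k k)) (down_rel m) i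
        h₀ h₁).eq_of_src _ _

lemma exists_d_eq_of_homotopy {K : ChainComplex (ModuleCat.{u} k) ℕ} (h : Homotopy (𝟙 K) 0) {n : ℕ}
    {x : K.X n} (hx : K.IsCycle x) : ∃ y, K.d (n + 1) n y = x := by
  refine ⟨h.hom n (n + 1) x, ?_⟩
  have h₁ := ConcreteCategory.congr_hom (h.comm n) x
  rw [prevD_eq _ (down_rel n)] at h₁
  have h₂ : dNext n h.hom x = 0 := by
    rw [dNext_eq_dFrom_fromNext, ConcreteCategory.comp_apply, HomologicalComplex.dFrom, hx,
      map_zero]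
  refine Eq.trans ?_ h₁.symm
  change _ = dNext n h.hom x + K.d (n + 1) n (h.hom n (n + 1) x) + 0
  rw [h₂, zero_add, add_zero]

/-- Tensoring the contraction of the disk with `L` contracts the tensor product. -/
lemma exists_d_eq_of_disk_tensor (m : ℕ) (L : FinTypeCh k) {n : ℕ} {x : (disk k m ⊗ L).obj.X n}
    (hx : (disk k m ⊗ L).obj.IsCycle x) : ∃ y, (disk k m ⊗ L).obj.d (n + 1) n y = x := by
  refine exists_d_eq_of_homotopy ?_ hx
  refine (Homotopy.ofEq ?_).trans ((HomologicalComplex.mapBifunctorMapHomotopy₁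
    (diskHomotopy m) (𝟙 L.obj)
    (curriedTensor (ModuleCat.{u} k)) (ComplexShape.down ℕ)).trans (Homotopy.ofEq ?_))
  · exact (id_whiskerRight (disk k m).obj L.obj).symm
  · ext n : 1
    change ((0 : (disk k m).obj ⟶ _) ▷ L.obj).f n = 0
    rw [whiskerRight_f]
    refine tensor_hom_ext (fun i j h ↦ ?_)
    rw [ι_gradedTensor]
    simp

lemma isZero_disk_X (m : ℕ) {i : ℕ} (h₀ : i ≠ m + 1) (h₁ : i ≠ m) : IsZero ((disk k m).obj.X i) :=
  HomologicalComplex.isZero_double_X (𝟙 (ModuleCat.of k k)) (down_rel m) i h₀ h₁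

lemma isZero_sphere_X (n : ℕ) {i : ℕ} (h : i ≠ n) : IsZero ((sphere k n).obj.X i) :=
  HomologicalComplex.isZero_single_obj_X _ _ _ _ h

variable (k) in
/-- The identification of the top degree part of a disk. -/
def diskTop (m : ℕ) : (disk k m).obj.X (m + 1) ≅ ModuleCat.of k k :=
  HomologicalComplex.doubleXIso₀ (𝟙 (ModuleCat.of k k)) (down_rel m)

variable (k) in
/-- The identification of the bottom degree part of a disk. -/
def diskBot (m : ℕ) : (disk k m).obj.X m ≅ ModuleCat.of k k :=
  HomologicalComplex.doubleXIso₁ (𝟙 (ModuleCat.of k k)) (down_rel m) (by simp)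

variable (k) in
/-- The identification of the nonzero part of a sphere. -/
def sphereIso (n : ℕ) : (sphere k n).obj.X n ≅ ModuleCat.of k k :=
  HomologicalComplex.singleObjXSelf _ n (ModuleCat.of k k)

lemma disk_d (m : ℕ) : (disk k m).obj.d (m + 1) m = (diskTop k m).hom ≫ (diskBot k m).inv :=
  (HomologicalComplex.double_d (𝟙 (ModuleCat.of k k)) (down_rel m) (by simp)).trans (by
    rw [Category.id_comp]
    rfl)

lemma diskToSphere_f (m : ℕ) :
    (diskToSphere k m).hom.f (m + 1) = (diskTop k m).hom ≫ (sphereIso k (m + 1)).inv := by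
  dsimp only [diskToSphere]
  exact HomologicalComplex.mkHomFromDouble_f₀ (down_rel m) (by simp) _ _ (by
    rw [HomologicalComplex.single_obj_d, Limits.comp_zero, Limits.comp_zero]) (by simp)

variable (K : FinTypeCh k)

/-- The chain map to a disk given by a linear form. -/
def toDisk (m : ℕ) (ψ : K.obj.X m ⟶ ModuleCat.of k k) : K ⟶ disk k m :=
  ObjectProperty.homMk
    { f := fun i ↦ if h₀ : i = m + 1 then
          (K.obj.XIsoOfEq h₀).hom ≫ K.obj.d (m + 1) m ≫ ψ ≫ (diskTop k m).inv ≫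
            ((disk k m).obj.XIsoOfEq h₀).inv
        else if h₁ : i = m then (K.obj.XIsoOfEq h₁).hom ≫ ψ ≫ (diskBot k m).inv ≫
            ((disk k m).obj.XIsoOfEq h₁).inv
        else 0
      comm' := by
        rintro _ i rfl
        by_cases h₀ : i = m + 1
        · rw [HomologicalComplex.double_d_eq_zero₁ (𝟙 (ModuleCat.of k k)) (down_rel m) _ _
            (by lia), comp_zero, dif_pos h₀]
          subst h₀
          simp
        by_cases h₁ : i = m
        · subst h₁
          rw [dif_pos rfl, dif_neg (by simp), dif_pos rfl, disk_d]
          simp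
        · exact (isZero_disk_X m h₀ h₁).eq_of_tgt _ _ }

lemma toDisk_f_bot (m : ℕ) (ψ : K.obj.X m ⟶ ModuleCat.of k k) :
    (toDisk K m ψ).hom.f m = ψ ≫ (diskBot k m).inv := by
  refine (dif_neg (by simp)).trans ((dif_pos rfl).trans ?_)
  simp

/-- The chain map to a sphere given by a linear form vanishing on boundaries. -/
def toSphere (n : ℕ) (φ : K.obj.X n ⟶ ModuleCat.of k k) (h : K.obj.d (n + 1) n ≫ φ = 0) :
    K ⟶ sphere k n :=
  ObjectProperty.homMk (HomologicalComplex.mkHomToSingle φ (by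
    rintro _ rfl
    exact h))

lemma toSphere_f (n : ℕ) (φ : K.obj.X n ⟶ ModuleCat.of k k) (h : K.obj.d (n + 1) n ≫ φ = 0) :
    (toSphere K n φ h).hom.f n = φ ≫ (sphereIso k n).inv :=
  HomologicalComplex.mkHomToSingle_f φ (by
    rintro _ rfl
    exact h)

lemma to_sphere_hom_ext {n : ℕ} {f g : K ⟶ sphere k n} (h : f.hom.f n = g.hom.f n) : f = g := by
  exact ObjectProperty.hom_ext _ (HomologicalComplex.to_single_hom_ext h)

end

end FinTypeCh

/-! ## Limits and colimits of comodules -/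

namespace RightComodule

open Limits

variable {M : Type u} [Category.{v} M] [MonoidalCategory M] {C : M} [ComonObj C]

lemma coact_coact (N : RightComodule C) :
    N.coact ≫ N.X ◁ ComonObj.comul ≫ (α_ N.X C C).inv = N.coact ≫ N.coact ▷ C := by
  have := N.coact_coassoc
  rw [← reassoc_of% this, Iso.hom_inv_id, Category.comp_id]

lemma comp_comul_of_eq {X : M} {a : X ⟶ X ⊗ C}
    (h : a ≫ a ▷ C = a ≫ X ◁ ComonObj.comul ≫ (α_ X C C).inv) :
    a ≫ a ▷ C ≫ (α_ X C C).hom = a ≫ X ◁ ComonObj.comul := by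
  rw [reassoc_of% h, Iso.inv_hom_id, Category.comp_id]

lemma comp_counit_of_eq {X : M} {a : X ⟶ X ⊗ C}
    (h : a ≫ X ◁ ComonObj.counit ≫ (ρ_ X).hom = 𝟙 X) :
    a ≫ X ◁ ComonObj.counit = (ρ_ X).inv := by
  rw [← cancel_mono (ρ_ X).hom, Category.assoc, h, Iso.inv_hom_id]

lemma coact_counit' (N : RightComodule C) :
    N.coact ≫ N.X ◁ ComonObj.counit ≫ (ρ_ N.X).hom = 𝟙 _ := by
  rw [← Category.assoc, N.coact_counit, Iso.inv_hom_id]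

variable (C)

/-- The comonad `- ⊗ C`. -/
def tensorComonad : Comonad M where
  toFunctor := tensorRight C
  δ := { app := fun X ↦ X ◁ ComonObj.comul ≫ (α_ X C C).inv
         naturality := fun X Y f ↦ ((cofree C).map f).comm.symm }
  ε := { app := fun X ↦ X ◁ ComonObj.counit ≫ (ρ_ X).hom
         naturality := fun X Y f ↦ by
          dsimp
          rw [← whisker_exchange_assoc, rightUnitor_naturality, Category.assoc] }
  coassoc X := (coact_coact (cofreeObj C X)).symm
  left_counit X := coact_counit' (cofreeObj C X)
  right_counit X := by
    dsimp
    rw [comp_whiskerRight, Category.assoc, ← associator_inv_naturality_middle_assoc,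
      ← whiskerLeft_comp_assoc, ComonObj.counit_comul]
    simp

/-- Right comodules as coalgebras over the comonad `- ⊗ C`. -/
def toCoalgebra : RightComodule C ⥤ (tensorComonad C).Coalgebra where
  obj N :=
    { A := N.X
      a := N.coact
      counit := coact_counit' N
      coassoc := coact_coact N }
  map f := { f := Hom.hom f, h := Hom.comm f }

/-- Coalgebras over the comonad `- ⊗ C` as right comodules. -/
def ofCoalgebra : (tensorComonad C).Coalgebra ⥤ RightComodule C where
  obj N :=
    { X := N.A
      coact := N.a
      coact_coassoc := comp_comul_of_eq N.coassoc.symm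
      coact_counit := comp_counit_of_eq N.counit }
  map f := { hom := f.f, comm := f.h }

/-- Right comodules are the coalgebras over the comonad `- ⊗ C`. -/
def equivCoalgebra : RightComodule C ≌ (tensorComonad C).Coalgebra where
  functor := toCoalgebra C
  inverse := ofCoalgebra C
  unitIso := Iso.refl _
  counitIso := Iso.refl _
  functor_unitIso_comp X := Category.comp_id (𝟙 ((toCoalgebra C).obj X))

variable {C} in
/-- The morphism to a cofree comodule given by a morphism from the underlying object. -/
def homMk (N : RightComodule C) {Y : M} (g : N.X ⟶ Y) : N ⟶ (cofree C).obj Y where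
  hom := N.coact ≫ g ▷ C
  comm := by
    change N.coact ≫ (N.coact ≫ g ▷ C) ▷ C =
      (N.coact ≫ g ▷ C) ≫ Y ◁ ComonObj.comul ≫ (α_ Y C C).inv
    have h := coact_coact N
    rw [comp_whiskerRight, ← reassoc_of% h, Category.assoc, ← whisker_exchange_assoc,
      associator_inv_naturality_left]

variable {C} in
lemma homMk_hom_counit (N : RightComodule C) {Y : M} (g : N.X ⟶ Y) :
    Hom.hom (N.homMk g) ≫ Y ◁ ComonObj.counit ≫ (ρ_ Y).hom = g := by
  change (N.coact ≫ g ▷ C) ≫ Y ◁ ComonObj.counit ≫ (ρ_ Y).hom = g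
  rw [Category.assoc, ← whisker_exchange_assoc, rightUnitor_naturality,
    ← Category.assoc, ← Category.assoc, Category.assoc N.coact, coact_counit', Category.id_comp]

variable {C} in
lemma hom_to_cofree_ext {N : RightComodule C} {Y : M} {f g : N ⟶ (cofree C).obj Y}
    (h : Hom.hom f ≫ Y ◁ ComonObj.counit ≫ (ρ_ Y).hom =
      Hom.hom g ≫ Y ◁ ComonObj.counit ≫ (ρ_ Y).hom) : f = g := by
  have H (f : N ⟶ (cofree C).obj Y) :
      f = N.homMk (Hom.hom f ≫ Y ◁ ComonObj.counit ≫ (ρ_ Y).hom) := by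
    apply hom_ext
    have h₁ := Hom.comm f
    change N.coact ≫ Hom.hom f ▷ C =
      Hom.hom f ≫ Y ◁ ComonObj.comul ≫ (α_ Y C C).inv at h₁
    change Hom.hom f = N.coact ≫ (Hom.hom f ≫ Y ◁ ComonObj.counit ≫ (ρ_ Y).hom) ▷ C
    rw [comp_whiskerRight, reassoc_of% h₁]
    have h₂ := (tensorComonad C).right_counit Y
    change (Y ◁ ComonObj.comul ≫ (α_ Y C C).inv) ≫ (Y ◁ ComonObj.counit ≫ (ρ_ Y).hom) ▷ C =
      𝟙 _ at h₂
    rw [Category.assoc] at h₂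
    rw [h₂]
    exact (Category.comp_id _).symm
  rw [H f, H g, h]

/-- The cofree comodule functor is right adjoint to the forgetful functor. -/
def adj : forget C ⊣ cofree C :=
  Adjunction.mkOfHomEquiv
    { homEquiv := fun N Y ↦
        { toFun := fun g ↦ N.homMk g
          invFun := fun f ↦ Hom.hom f ≫ Y ◁ ComonObj.counit ≫ (ρ_ Y).hom
          left_inv := fun g ↦ homMk_hom_counit N g
          right_inv := fun f ↦ hom_to_cofree_ext (homMk_hom_counit N _) }
      homEquiv_naturality_left_symm := fun f g ↦ Category.assoc _ _ _
      homEquiv_naturality_right := fun {N Y Y'} f g ↦ hom_ext (by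
        change N.coact ≫ (f ≫ g) ▷ C = (N.coact ≫ f ▷ C) ≫ g ▷ C
        rw [comp_whiskerRight, Category.assoc]) }

section

variable {J : Type*} [Category* J] (D : J ⥤ RightComodule C)

instance : (toCoalgebra C).IsEquivalence := (equivCoalgebra C).isEquivalence_functor

/-- The forgetful functor from coalgebras creates those limits that the comonad and its square
preserve. A statement for a single diagram is used both for finite limits and for stable towers. -/
lemma hasLimit_of_preservesLimit [HasLimit (D ⋙ forget C)]
    [PreservesLimit (D ⋙ forget C) (tensorRight C)]
    [PreservesLimit ((D ⋙ forget C) ⋙ tensorRight C) (tensorRight C)] :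
    HasLimit D ∧ PreservesLimit D (forget C) := by
  let D' := D ⋙ toCoalgebra C
  have : HasLimit (D' ⋙ Comonad.forget _) := ‹HasLimit (D ⋙ forget C)›
  have : PreservesLimit (D' ⋙ Comonad.forget _) (tensorComonad C).toFunctor :=
    ‹PreservesLimit (D ⋙ forget C) (tensorRight C)›
  have : PreservesLimit ((D' ⋙ Comonad.forget _) ⋙ (tensorComonad C).toFunctor)
      (tensorComonad C).toFunctor :=
    ‹PreservesLimit ((D ⋙ forget C) ⋙ tensorRight C) (tensorRight C)›
  have h₁ : CreatesLimit D' (Comonad.forget (tensorComonad C)) := inferInstance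
  have h₂ : HasLimit D' := hasLimit_of_created D' (Comonad.forget (tensorComonad C))
  have h₃ : PreservesLimit D' (Comonad.forget (tensorComonad C)) := inferInstance
  have h₄ : PreservesLimit D (toCoalgebra C ⋙ Comonad.forget (tensorComonad C)) :=
    inferInstance
  exact ⟨Adjunction.hasLimit_of_comp_equivalence D (toCoalgebra C), h₄⟩

instance [HasFiniteLimits M] [PreservesFiniteLimits (tensorRight C)] :
    HasFiniteLimits (RightComodule C) :=
  ⟨fun _ _ _ ↦ ⟨fun D ↦ (hasLimit_of_preservesLimit C D).1⟩⟩

instance [HasFiniteLimits M] [PreservesFiniteLimits (tensorRight C)] :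
    PreservesFiniteLimits (forget C) :=
  ⟨fun _ _ _ ↦ ⟨fun {D} ↦ (hasLimit_of_preservesLimit C D).2⟩⟩

instance [HasFiniteColimits M] : HasFiniteColimits (RightComodule C) :=
  ⟨fun J _ _ ↦ by
    have : HasColimitsOfShape J (tensorComonad C).Coalgebra :=
      ⟨fun D ↦ hasColimit_of_created D (Comonad.forget (tensorComonad C))⟩
    exact Adjunction.hasColimitsOfShape_of_equivalence (toCoalgebra C)⟩

end

end RightComodule

/-! ## Limits of degreewise stable towers -/

namespace FinTypeCh

open Limits Opposite

variable {k : Type u} [Field k]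

/-- The towers of chain complexes which are eventually constant in each degree. -/
def IsStableTower (G : ℕᵒᵖ ⥤ FinTypeCh k) : Prop :=
  ∀ n, ∃ a, (G ⋙ eval k n).IsEventuallyConstantTo (op a)

namespace IsStableTower

variable {G : ℕᵒᵖ ⥤ FinTypeCh k} (hG : IsStableTower G)

lemma nonempty_isLimit {c : Cone G}
    (h : ∀ n, ∃ a, (G ⋙ eval k n).IsEventuallyConstantTo (op a) ∧
      IsIso ((c.π.app (op a)).hom.f n)) : Nonempty (IsLimit c) := by
  refine ⟨isLimitOfReflects (finiteType k).ι (HomologicalComplex.isLimitOfEval _ _ (fun n ↦ ?_))⟩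
  have : IsIso (((eval k n).mapCone c).π.app (op (h n).choose)) := (h n).choose_spec.2
  exact (h n).choose_spec.1.isLimitOfIsIso ((eval k n).mapCone c)

include hG

/-- The limit among all complexes is computed degreewise. In each degree it agrees with some stage
of the tower, so it is finite dimensional. -/
lemma nonempty_createsLimit :
    HasLimit (G ⋙ (finiteType k).ι) ∧ Nonempty (CreatesLimit G (finiteType k).ι) ∧
      ∀ n, PreservesLimit (G ⋙ (finiteType k).ι) (HomologicalComplex.eval _ _ n) := by
  have (n : ℕ) : HasLimit ((G ⋙ (finiteType k).ι) ⋙ HomologicalComplex.eval _ _ n) :=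
    (hG n).choose_spec.hasLimit
  refine ⟨inferInstance, ⟨createsLimitFullSubcategoryInclusion' G
    (limit.isLimit (G ⋙ (finiteType k).ι)) (fun n ↦ ?_)⟩, inferInstance⟩
  obtain ⟨a, ha⟩ := hG n
  have : IsIso ((limit.π (G ⋙ (finiteType k).ι) (op a)).f n) := ha.isIso_π_of_isLimit
    (isLimitOfPreserves (HomologicalComplex.eval _ _ n) (limit.isLimit (G ⋙ (finiteType k).ι)))
  have hfin : Module.Finite k ((G.obj (op a)).obj.X n) := (G.obj (op a)).property n
  let e : (limit (G ⋙ (finiteType k).ι)).X n ≅ (G.obj (op a)).obj.X n :=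
    asIso ((limit.π (G ⋙ (finiteType k).ι) (op a)).f n)
  exact Module.Finite.equiv e.symm.toLinearEquiv

lemma hasLimit : HasLimit G := by
  obtain ⟨_, ⟨_⟩, -⟩ := hG.nonempty_createsLimit
  exact hasLimit_of_created G (finiteType k).ι

lemma isIso_π {c : Cone G} (hc : IsLimit c) {n a : ℕ}
    (ha : (G ⋙ eval k n).IsEventuallyConstantTo (op a)) : IsIso ((c.π.app (op a)).hom.f n) := by
  obtain ⟨_, ⟨_⟩, _⟩ := hG.nonempty_createsLimit
  exact ha.isIso_π_of_isLimit (isLimitOfPreserves (HomologicalComplex.eval _ _ n)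
    (isLimitOfPreserves (finiteType k).ι hc))

variable (C : FinTypeCh k)

/-- Degree `n` of a tensor product only involves degrees at most `n` of the factor, so a maximum
over finitely many stages suffices. -/
lemma tensorRight : IsStableTower (G ⋙ tensorRight C) := by
  intro n
  have hG' := hG
  choose a ha using hG'
  refine ⟨(Finset.range (n + 1)).sup a, fun b f ↦ ?_⟩
  refine isIso_whiskerRight_f (G.map f) C n (fun i hi ↦ ?_)
  exact (ha i).isIso_map f (homOfLE (Finset.le_sup (f := a) (by simpa using by lia))).op

lemma preservesLimit_tensorRight : PreservesLimit G (MonoidalCategory.tensorRight C) := by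
  have := hG.hasLimit
  refine preservesLimit_of_preserves_limit_cone (limit.isLimit G) (Nonempty.some ?_)
  refine nonempty_isLimit (fun n ↦ ?_)
  obtain ⟨b, hb⟩ := hG.tensorRight C n
  have hG' := hG
  choose a ha using hG'
  let m := max b ((Finset.range (n + 1)).sup a)
  refine ⟨m, hb.precomp (homOfLE (le_max_left _ _)).op, ?_⟩
  refine isIso_whiskerRight_f (limit.π G (op m)) C n (fun i hi ↦ ?_)
  exact hG.isIso_π (limit.isLimit G) ((ha i).precomp (homOfLE (le_trans
    (Finset.le_sup (f := a) (by simpa using by lia)) (le_max_right _ _))).op)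

end IsStableTower

lemma exists_isLimit_comodule {C : FinTypeCh k} [ComonObj C] {D : ℕᵒᵖ ⥤ RightComodule C}
    (hD : IsStableTower (D ⋙ RightComodule.forget C)) :
    ∃ (c : Cone D) (_ : IsLimit c), ∀ n a,
      ((D ⋙ RightComodule.forget C) ⋙ eval k n).IsEventuallyConstantTo (op a) →
        IsIso ((c.π.app (op a)).hom.hom.f n) := by
  have := hD.hasLimit
  have := hD.preservesLimit_tensorRight C
  have := (hD.tensorRight C).preservesLimit_tensorRight C
  obtain ⟨h, h'⟩ := RightComodule.hasLimit_of_preservesLimit C D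
  exact ⟨limit.cone D, limit.isLimit D, fun n a ha ↦
    hD.isIso_π (isLimitOfPreserves (RightComodule.forget C) (limit.isLimit D)) ha⟩

end FinTypeCh

/-! ## Dimension counts -/

section

variable {k V W : Type*} [Field k] [AddCommGroup V] [Module k V] [AddCommGroup W] [Module k W]
  [FiniteDimensional k V]

lemma LinearMap.finrank_comap_of_surjective {f : V →ₗ[k] W} (hf : Function.Surjective f)
    (S : Submodule k W) :
    Module.finrank k (S.comap f) = Module.finrank k S + Module.finrank k (ker f) := by
  have h := LinearMap.finrank_range_add_finrank_ker (f.domRestrict (S.comap f))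
  have h₁ : range (f.domRestrict (S.comap f)) = S := by
    rw [LinearMap.range_domRestrict, Submodule.map_comap_eq_of_surjective hf]
  have h₂ : Module.finrank k (ker (f.domRestrict (S.comap f))) = Module.finrank k (ker f) := by
    rw [LinearMap.ker_domRestrict]
    exact (Submodule.comapSubtypeEquivOfLe (Submodule.comap_mono bot_le)).finrank_eq
  rw [h₁, h₂] at h
  exact h.symm

end

namespace ChainComplex

variable {k : Type u} [Field k] {K L L' : ChainComplex (ModuleCat.{u} k) ℕ}

/-- The dimension of the kernel of a chain map in degree `n`. -/
def kerDim (f : K ⟶ L) (n : ℕ) : ℕ := Module.finrank k (LinearMap.ker (f.f n).hom)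

/-- The dimension of the homology in degree `n` of the cokernel of an injective chain map. -/
def homDim (f : K ⟶ L) (n : ℕ) : ℕ :=
  Module.finrank k (relCycles f n) - Module.finrank k (relBoundaries f n)

lemma kerDim_eq_zero_iff (hK : finiteType k K) {f : K ⟶ L} {n : ℕ} :
    kerDim f n = 0 ↔ Function.Injective (f.f n) := by
  have := hK n
  rw [kerDim, Submodule.finrank_eq_zero, LinearMap.ker_eq_bot]

lemma homDim_eq_zero_iff (hL : finiteType k L) {f : K ⟶ L} {n : ℕ} :
    homDim f n = 0 ↔ relCycles f n ≤ relBoundaries f n := by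
  have := hL n
  rw [homDim, Nat.sub_eq_zero_iff_le]
  refine ⟨fun h ↦ ?_, fun h ↦ Submodule.finrank_mono h⟩
  rw [Submodule.eq_of_le_of_finrank_le (relBoundaries_le_relCycles f n) h]

lemma kerDim_lt (hK : finiteType k K) {f : K ⟶ L} {f' : K ⟶ L'} {a : L' ⟶ L} (h : f' ≫ a = f)
    {n : ℕ} {x : K.X n} (hx : f.f n x = 0) (hx' : f'.f n x ≠ 0) : kerDim f' n < kerDim f n := by
  have := hK n
  refine Submodule.finrank_lt_finrank_of_lt (SetLike.lt_iff_le_and_exists.2 ⟨fun y hy ↦ ?_,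
    x, hx, hx'⟩)
  have h₁ : f'.f n y = 0 := hy
  change f.f n y = 0
  rw [← h]
  exact (congrArg (a.f n) h₁).trans (map_zero _)

section

variable {f : K ⟶ L} {f' : K ⟶ L'} {a : L' ⟶ L} (h : f' ≫ a = f)

include h

lemma comp_f_apply (n : ℕ) (x : K.X n) : a.f n (f'.f n x) = f.f n x := by
  rw [← h]
  rfl

lemma relCycles_eq_comap {n : ℕ} (ha : ∀ i < n, Function.Injective (a.f i)) :
    relCycles f' n = (relCycles f n).comap (a.f n).hom := by
  ext y
  rw [Submodule.mem_comap, mem_relCycles, mem_relCycles]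
  refine ⟨fun hy m ↦ ?_, fun hy m ↦ ?_⟩
  · obtain ⟨x, hx⟩ := hy m
    exact ⟨x, by rw [← comp_f_apply h, hx]; exact comm_apply a n m y⟩
  · obtain ⟨x, hx⟩ := hy m
    by_cases hm : (ComplexShape.down ℕ).Rel n m
    · refine ⟨x, ha m (by simp at hm; lia) ?_⟩
      rw [comp_f_apply h, hx]
      exact (comm_apply a n m y).symm
    · refine ⟨0, ?_⟩
      rw [map_zero, L'.shape _ _ hm]
      rfl

lemma map_relBoundaries {n : ℕ} (ha : Function.Surjective (a.f (n + 1))) :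
    relBoundaries f n = (relBoundaries f' n).map (a.f n).hom := by
  ext y
  rw [Submodule.mem_map, mem_relBoundaries]
  constructor
  · rintro ⟨x, z, rfl⟩
    obtain ⟨z, rfl⟩ := ha z
    refine ⟨f'.f n x + L'.d (n + 1) n z, mem_relBoundaries.2 ⟨x, z, rfl⟩, ?_⟩
    exact (map_add (a.f n).hom _ _).trans
      (congrArg₂ (· + ·) (comp_f_apply h n x) (comm_apply a (n + 1) n z))
  · rintro ⟨y, hy, rfl⟩
    obtain ⟨x, z, rfl⟩ := mem_relBoundaries.1 hy
    refine ⟨x, a.f (n + 1) z, ?_⟩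
    exact ((map_add (a.f n).hom _ _).trans
      (congrArg₂ (· + ·) (comp_f_apply h n x) (comm_apply a (n + 1) n z))).symm

lemma relBoundaries_eq_comap {n : ℕ} (ha : Function.Surjective (a.f (n + 1)))
    (hker : ∀ y, a.f n y = 0 → y ∈ relBoundaries f' n) :
    relBoundaries f' n = (relBoundaries f n).comap (a.f n).hom := by
  rw [map_relBoundaries h ha, Submodule.comap_map_eq]
  exact (sup_eq_left.2 hker).symm

/-- Both submodules for `f'` are preimages of those for `f` under a surjection, so both dimensions
grow by that of its kernel. -/
lemma homDim_eq (hL' : finiteType k L') {n : ℕ} (ha₀ : ∀ i < n, Function.Injective (a.f i))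
    (ha₁ : Function.Surjective (a.f n)) (ha₂ : Function.Surjective (a.f (n + 1)))
    (hker : ∀ y, a.f n y = 0 → y ∈ relBoundaries f' n) : homDim f' n = homDim f n := by
  have := hL' n
  rw [homDim, homDim, relCycles_eq_comap h ha₀, relBoundaries_eq_comap h ha₂ hker,
    LinearMap.finrank_comap_of_surjective ha₁, LinearMap.finrank_comap_of_surjective ha₁,
    Nat.add_sub_add_right]

lemma kerDim_eq_of_injective {n : ℕ} (ha : Function.Injective (a.f n)) :
    kerDim f' n = kerDim f n := by
  have : LinearMap.ker (f'.f n).hom = LinearMap.ker (f.f n).hom := by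
    ext x
    change f'.f n x = 0 ↔ f.f n x = 0
    rw [← comp_f_apply h]
    exact (map_eq_zero_iff (a.f n).hom ha).symm
  rw [kerDim, kerDim, this]

lemma homDim_eq_of_bijective (hL' : finiteType k L') {n : ℕ}
    (ha₁ : ∀ i ≤ n, Function.Bijective (a.f i)) (ha₂ : Function.Surjective (a.f (n + 1))) :
    homDim f' n = homDim f n :=
  homDim_eq h hL' (fun i hi ↦ (ha₁ i hi.le).1) (ha₁ n le_rfl).2 ha₂ (fun y hy ↦ by
    obtain rfl : y = 0 := (map_eq_zero_iff (a.f n).hom (ha₁ n le_rfl).1).1 hy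
    exact zero_mem _)

/-- The relative cycles of `f'` embed in those of `f` and miss `z`, while the relative boundaries do
not lose dimension. -/
lemma homDim_lt (hL : finiteType k L) (hL' : finiteType k L') {n : ℕ}
    (ha₁ : Function.Injective (a.f n)) (ha₂ : Function.Surjective (a.f (n + 1)))
    {z : L.X n} (hz : z ∈ relCycles f n) (hz' : ∀ y ∈ relCycles f' n, a.f n y ≠ z) :
    homDim f' n < homDim f n := by
  have := hL n
  have := hL' n
  have h₁ : Module.finrank k (relCycles f' n) < Module.finrank k (relCycles f n) := by
    rw [(Submodule.equivMapOfInjective (a.f n).hom ha₁ (relCycles f' n)).finrank_eq]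
    refine Submodule.finrank_lt_finrank_of_lt (SetLike.lt_iff_le_and_exists.2 ⟨?_, z, hz, ?_⟩)
    · rintro _ ⟨y, hy, rfl⟩
      refine mem_relCycles.2 (fun m ↦ ?_)
      obtain ⟨x, hx⟩ := mem_relCycles.1 hy m
      exact ⟨x, by rw [← comp_f_apply h, hx]; exact comm_apply a n m y⟩
    · rintro ⟨y, hy, rfl⟩
      exact hz' y hy rfl
  have h₂ : Module.finrank k (relBoundaries f n) ≤ Module.finrank k (relBoundaries f' n) := by
    rw [map_relBoundaries h ha₂]
    exact Submodule.finrank_map_le _ _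
  -- This excludes truncation in the subtraction defining `homDim`.
  have h₃ := Submodule.finrank_mono (relBoundaries_le_relCycles f' n)
  rw [homDim, homDim]
  lia

end

lemma quasiIsoAt_of_bijective {a : L' ⟶ L} {n : ℕ} (ha : ∀ i ≤ n, Function.Bijective (a.f i))
    (ha' : Function.Surjective (a.f (n + 1))) : QuasiIsoAt a n := by
  rw [quasiIsoAt_iff]
  constructor
  · intro x _ y h
    obtain ⟨x', rfl⟩ := ha' y
    exact ⟨x', (ha n le_rfl).1 (by rw [h, comm_apply])⟩
  · intro y hy
    obtain ⟨x, rfl⟩ := (ha n le_rfl).2 y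
    refine ⟨x, 0, fun m ↦ ?_, by simp⟩
    by_cases hm : (ComplexShape.down ℕ).Rel n m
    · refine (ha m (by simp at hm; lia)).1 ?_
      rw [comm_apply, hy m, map_zero]
    · rw [L'.shape _ _ hm]
      rfl

end ChainComplex

/-! ## Pullbacks of cofree maps -/

namespace FinTypeCh

open Limits

variable {k : Type u} [Field k] {C : FinTypeCh k} [ComonObj C]

lemma counit_naturality {K L : FinTypeCh k} (f : K ⟶ L) : f ▷ C ≫ counit C L = counit C K ≫ f := by
  rw [counit, counit, ← whisker_exchange_assoc, rightUnitor_naturality, Category.assoc]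

section

variable {Y Y' : RightComodule C} {D S : FinTypeCh k} {q : D ⟶ S} {φ : Y.X ⟶ S} {a : Y' ⟶ Y}
  {b : Y' ⟶ (RightComodule.cofree C).obj D}
  (sq : IsPullback b a ((RightComodule.cofree C).map q) (Y.homMk φ))

/-- The chain map corresponding to a comodule map to a cofree comodule. -/
def unhom (b : Y' ⟶ (RightComodule.cofree C).obj D) : Y'.X ⟶ D := b.hom ≫ counit C D

lemma unhom_homMk {N : RightComodule C} (ψ : N.X ⟶ D) : unhom (N.homMk ψ) = ψ :=
  N.homMk_hom_counit ψ

lemma unhom_comp {N : RightComodule C} (h : N ⟶ Y') : unhom (h ≫ b) = h.hom ≫ unhom b :=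
  Category.assoc _ _ _

lemma unhom_map : unhom (b ≫ (RightComodule.cofree C).map q) = unhom b ≫ q := by
  rw [unhom, unhom, Category.assoc, ← counit_naturality]
  exact Category.assoc _ _ _

lemma unhom_ext {b' : Y' ⟶ (RightComodule.cofree C).obj D} (h : unhom b = unhom b') : b = b' :=
  RightComodule.hom_to_cofree_ext h

include sq

lemma unhom_comp_eq : unhom b ≫ q = a.hom ≫ φ := by
  rw [← unhom_map, sq.w, unhom_comp, unhom_homMk]

lemma exists_lift_of_isPullback {N : RightComodule C} (h : N ⟶ Y) (ψ : N.X ⟶ D)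
    (w : ψ ≫ q = h.hom ≫ φ) : ∃ h' : N ⟶ Y', h' ≫ a = h ∧ h'.hom ≫ unhom b = ψ := by
  refine ⟨sq.lift (N.homMk ψ) h (unhom_ext ?_), sq.lift_snd _ _ _, ?_⟩
  · rw [unhom_map, unhom_comp, unhom_homMk, unhom_homMk, w]
  · rw [← unhom_comp, sq.lift_fst, unhom_homMk]

lemma isPullback_types (i : ℕ) : IsPullback
    ((RightComodule.forget C ⋙ eval k i ⋙ CategoryTheory.forget _).map b)
    ((RightComodule.forget C ⋙ eval k i ⋙ CategoryTheory.forget _).map a)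
    ((RightComodule.forget C ⋙ eval k i ⋙ CategoryTheory.forget _).map
      ((RightComodule.cofree C).map q))
    ((RightComodule.forget C ⋙ eval k i ⋙ CategoryTheory.forget _).map (Y.homMk φ)) :=
  sq.map _

lemma exists_of_isPullback' {i : ℕ} (y : Y.X.obj.X i) (d : (D ⊗ C).obj.X i)
    (h : (q ▷ C).hom.f i d = (Y.homMk φ).hom.hom.f i y) :
    ∃ y', a.hom.hom.f i y' = y ∧ b.hom.hom.f i y' = d := by
  obtain ⟨y', h₁, h₂⟩ := Types.exists_of_isPullback (isPullback_types sq i) d y h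
  exact ⟨y', h₂, h₁⟩

lemma eq_zero_of_isPullback' {i : ℕ} {y' : Y'.X.obj.X i} (h₁ : a.hom.hom.f i y' = 0)
    (h₂ : b.hom.hom.f i y' = 0) : y' = 0 :=
  Types.ext_of_isPullback (isPullback_types sq i) (h₂.trans (map_zero (b.hom.hom.f i).hom).symm)
    (h₁.trans (map_zero (a.hom.hom.f i).hom).symm)

/-- Where the counits of `D` and `S` are isomorphisms, the pullback of the cofree map agrees with
the pullback of `q` along `φ` in complexes. -/
lemma exists_of_isPullback {i : ℕ} (hD : IsIso ((counit C D).hom.f i))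
    (hS : IsIso ((counit C S).hom.f i)) (y : Y.X.obj.X i) (d : D.obj.X i)
    (h : φ.hom.f i y = q.hom.f i d) :
    ∃ y', a.hom.hom.f i y' = y ∧ (unhom b).hom.f i y' = d := by
  obtain ⟨d, rfl⟩ := ((ConcreteCategory.isIso_iff_bijective _).1 hD).2 d
  obtain ⟨y', h₁, h₂⟩ := exists_of_isPullback' sq y d (by
    refine ((ConcreteCategory.isIso_iff_bijective _).1 hS).1 ?_
    have h₁ := congrArg (fun f ↦ f.hom.f i d) (counit_naturality (C := C) q)
    have h₂ := congrArg (fun f ↦ f.hom.f i y) (unhom_homMk (N := Y) φ)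
    exact h₁.trans (h.symm.trans h₂.symm))
  exact ⟨y', h₁, congrArg ((counit C D).hom.f i) h₂⟩

lemma eq_zero_of_isPullback {i : ℕ} (hD : IsIso ((counit C D).hom.f i))
    {y' : Y'.X.obj.X i} (h₁ : a.hom.hom.f i y' = 0) (h₂ : (unhom b).hom.f i y' = 0) : y' = 0 := by
  refine eq_zero_of_isPullback' sq h₁
    (((ConcreteCategory.isIso_iff_bijective _).1 hD).1 (h₂.trans ?_))
  exact (map_zero ((counit C D).hom.f i).hom).symm

lemma surjective_of_isPullback {i : ℕ} (hS : IsIso ((counit C S).hom.f i))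
    (hS' : IsZero (S.obj.X i)) : Function.Surjective (a.hom.hom.f i) := by
  intro y
  have h : IsZero ((S ⊗ C).obj.X i) := hS'.of_iso (asIso ((counit C S).hom.f i))
  have := ModuleCat.subsingleton_of_isZero h
  obtain ⟨y', hy', -⟩ := exists_of_isPullback' sq y 0 (Subsingleton.elim _ _)
  exact ⟨y', hy'⟩

lemma bijective_of_isPullback {i : ℕ} (hD : IsIso ((counit C D).hom.f i))
    (hS : IsIso ((counit C S).hom.f i)) (hD' : IsZero (D.obj.X i)) (hS' : IsZero (S.obj.X i)) :
    Function.Bijective (a.hom.hom.f i) := by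
  refine ⟨?_, surjective_of_isPullback sq hS hS'⟩
  refine (injective_iff_map_eq_zero (a.hom.hom.f i).hom).2 (fun y hy ↦ ?_)
  have := ModuleCat.subsingleton_of_isZero hD'
  exact eq_zero_of_isPullback sq hD hy (Subsingleton.elim _ _)

end

lemma exists_isPullback (Y : RightComodule C) {D S : FinTypeCh k} (q : D ⟶ S) (φ : Y.X ⟶ S) :
    ∃ (Y' : RightComodule C) (a : Y' ⟶ Y) (b : Y' ⟶ (RightComodule.cofree C).obj D),
      IsPullback b a ((RightComodule.cofree C).map q) (Y.homMk φ) :=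
  ⟨_, _, _, IsPullback.of_hasPullback _ _⟩

/-- Since `S` is zero, `Y'` is the product of `Y` with the cofree comodule on a disk, whose
underlying complex is acyclic. -/
lemma quasiIso_of_isPullback_disk {Y Y' : RightComodule C} {m : ℕ} {S : FinTypeCh k}
    (hS : IsZero S) {q : disk k m ⟶ S} {φ : Y.X ⟶ S}
    {a : Y' ⟶ Y} {b : Y' ⟶ (RightComodule.cofree C).obj (disk k m)}
    (sq : IsPullback b a ((RightComodule.cofree C).map q) (Y.homMk φ)) : QuasiIso a.hom.hom := by
  have hS' (i : ℕ) (x y : (S ⊗ C).obj.X i) : x = y := by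
    have : IsZero ((S ⊗ C).obj.X i) :=
      (eval k i).map_isZero ((tensorRight C).map_isZero hS)
    have := ModuleCat.subsingleton_of_isZero this
    exact Subsingleton.elim _ _
  refine ⟨fun n ↦ ?_⟩
  rw [ChainComplex.quasiIsoAt_iff]
  constructor
  · intro x hx y h
    obtain ⟨w, hw⟩ := exists_d_eq_of_disk_tensor m C (hx.map b.hom.hom)
    obtain ⟨x', h₁, h₂⟩ := exists_of_isPullback' sq y w (hS' _ _ _)
    refine ⟨x', (sub_eq_zero.1 (eq_zero_of_isPullback' sq ?_ ?_)).symm⟩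
    · refine (map_sub (a.hom.hom.f n).hom _ _).trans (sub_eq_zero.2 (h.trans ?_))
      rw [← h₁]
      exact (ChainComplex.comm_apply a.hom.hom _ _ _).symm
    · refine (map_sub (b.hom.hom.f n).hom _ _).trans (sub_eq_zero.2 (hw.symm.trans ?_))
      rw [← h₂]
      exact (ChainComplex.comm_apply b.hom.hom _ _ _).symm
  · intro y hy
    obtain ⟨x, h₁, h₂⟩ := exists_of_isPullback' sq y 0 (hS' _ _ _)
    refine ⟨x, 0, fun m ↦ eq_zero_of_isPullback' sq ?_ ?_, ?_⟩
    · refine (ChainComplex.comm_apply a.hom.hom _ _ _).trans ?_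
      rw [h₁, hy m]
    · refine (ChainComplex.comm_apply b.hom.hom _ _ _).trans ?_
      rw [h₂]
      exact map_zero _
    · rw [h₁, map_zero, add_zero]

end FinTypeCh

namespace CategoryTheory.MorphismProperty

/-- The composites of two pullbacks of morphisms in a class of morphisms. -/
def twoPullbacks {C : Type*} [Category* C] (W : MorphismProperty C) : MorphismProperty C :=
  fun X Y a ↦ ∃ (Z : C) (p : X ⟶ Z) (q : Z ⟶ Y), W.pullbacks p ∧ W.pullbacks q ∧ p ≫ q = a

end CategoryTheory.MorphismProperty

/-! ## Elementary modifications of comodule maps -/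

namespace FinTypeCh

open Limits ChainComplex

variable {k : Type u} [Field k]

lemma isZero_zero : IsZero (zero k) := by
  rw [IsZero.iff_id_eq_zero]
  exact ObjectProperty.hom_ext _ ((Limits.isZero_zero _).eq_of_src _ _)

lemma isZero_zero_X (i : ℕ) : IsZero ((zero k).obj.X i) :=
  (eval k i).map_isZero isZero_zero

variable {C : FinTypeCh k} [ComonObj C]

variable (C) in
/-- The cofree maps on the generating maps for fibrations. -/
abbrev cofreeX : MorphismProperty (RightComodule C) :=
  (generatingX k).strictMap (RightComodule.cofree C)

variable (C) in
/-- The cofree maps on the generating maps for trivial fibrations. -/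
abbrev cofreeZ : MorphismProperty (RightComodule C) :=
  (generatingZ k).strictMap (RightComodule.cofree C)

lemma toDisk_f_bot_eq_zero_iff {K : FinTypeCh k} {m : ℕ} {ψ : K.obj.X m ⟶ ModuleCat.of k k}
    {x : K.obj.X m} : (toDisk K m ψ).hom.f m x = 0 ↔ ψ x = 0 := by
  rw [toDisk_f_bot]
  exact map_eq_zero_iff (diskBot k m).inv.hom
    ((ConcreteCategory.isIso_iff_bijective (diskBot k m).inv).1 inferInstance).1

lemma bijective_disk_d (m : ℕ) : Function.Bijective ((disk k m).obj.d (m + 1) m) := by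
  rw [disk_d]
  exact (ConcreteCategory.isIso_iff_bijective _).1 inferInstance

lemma toSphere_f_eq_zero_iff {K : FinTypeCh k} {n : ℕ} {φ : K.obj.X n ⟶ ModuleCat.of k k}
    {h : K.obj.d (n + 1) n ≫ φ = 0} {x : K.obj.X n} :
    (toSphere K n φ h).hom.f n x = 0 ↔ φ x = 0 := by
  rw [toSphere_f]
  exact map_eq_zero_iff (sphereIso k n).inv.hom
    ((ConcreteCategory.isIso_iff_bijective (sphereIso k n).inv).1 inferInstance).1

section

variable (η : Coaugmentation C) (hC : IsOneConnected C)

include η hC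

lemma isIso_counit_zero_f (i : ℕ) : IsIso ((counit C (zero k)).hom.f i) :=
  isIso_counit_tensor_f η hC _ i (fun _ _ ↦ isZero_zero_X _) i (by omega)

lemma isIso_counit_disk_f {m i : ℕ} (hi : i ≤ m + 1) : IsIso ((counit C (disk k m)).hom.f i) :=
  isIso_counit_tensor_f η hC _ m (fun _ _ ↦ isZero_disk_X _ (by omega) (by omega)) i hi

lemma isIso_counit_sphere_f {n i : ℕ} (hi : i ≤ n + 1) :
    IsIso ((counit C (sphere k n)).hom.f i) :=
  isIso_counit_tensor_f η hC _ n (fun _ _ ↦ isZero_sphere_X _ (by omega)) i hi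

variable {N Y : RightComodule C} (f : N ⟶ Y)

/-- `Y'` is the product of `Y` with the cofree comodule on the disk, and `ψ` gives the second
component of `f'`. With `ψ` nonzero on a kernel element this lowers the kernel; with `ψ = 0` it
serves as an idle step. -/
lemma exists_disk_block (m : ℕ) (ψ : N.X.obj.X m ⟶ ModuleCat.of k k) :
    ∃ (Y' : RightComodule C) (a : Y' ⟶ Y) (f' : N ⟶ Y'), f' ≫ a = f ∧
      (cofreeZ C).pullbacks a ∧ (cofreeX C).twoPullbacks a ∧ QuasiIso a.hom.hom ∧
      (∀ i < m, Function.Bijective (a.hom.hom.f i)) ∧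
      (∀ i, Function.Surjective (a.hom.hom.f i)) ∧
      homDim f'.hom.hom m = homDim f.hom.hom m ∧ ∀ x, f'.hom.hom.f m x = 0 → ψ x = 0 := by
  let q : disk k m ⟶ zero k := ObjectProperty.homMk 0
  obtain ⟨Y', a, b, sq⟩ := exists_isPullback Y q (isZero_zero.from_ Y.X)
  obtain ⟨f', h₁, h₂⟩ := exists_lift_of_isPullback sq f (toDisk N.X m ψ)
    (isZero_zero.eq_of_tgt _ _)
  have hbij (i : ℕ) (hi : i < m) : Function.Bijective (a.hom.hom.f i) :=
    bijective_of_isPullback sq (isIso_counit_disk_f η hC (by omega))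
      (isIso_counit_zero_f η hC i) (isZero_disk_X m (by omega) (by omega)) (isZero_zero_X _)
  have hsurj (i : ℕ) : Function.Surjective (a.hom.hom.f i) :=
    surjective_of_isPullback sq (isIso_counit_zero_f η hC i) (isZero_zero_X _)
  have h₁' : f'.hom.hom ≫ a.hom.hom = f.hom.hom :=
    congrArg (fun f ↦ f.hom.hom) h₁
  refine ⟨Y', a, f', h₁, MorphismProperty.pullbacks_mk _ sq ⟨.diskToZero m⟩, ?_,
    quasiIso_of_isPullback_disk isZero_zero sq, hbij, hsurj, ?_, fun x hx ↦ ?_⟩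
  -- Through the sphere, the same map is a composite of two pullbacks of cofree generators for
  -- fibrations.
  · have hq : q = diskToSphere k m ≫ (ObjectProperty.homMk 0 : sphere k (m + 1) ⟶ zero k) :=
      isZero_zero.eq_of_tgt _ _
    rw [hq, Functor.map_comp] at sq
    exact MorphismProperty.pullbacks_exists_fac sq _ ⟨.diskToSphere m⟩ ⟨.sphereToZero (m + 1)⟩
  · refine homDim_eq h₁' Y'.X.property (fun i hi ↦ (hbij i hi).1) (hsurj m) (hsurj (m + 1)) ?_
    intro y hy
    -- The new elements of degree `m` come from the bottom of the disk and are boundaries of its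
    -- top, so the relative homology does not change.
    obtain ⟨w, hw⟩ := (bijective_disk_d m).2 ((unhom b).hom.f m y)
    have hzero (j : ℕ) (u v : (zero k).obj.X j) : u = v := by
      have := ModuleCat.subsingleton_of_isZero (isZero_zero_X (k := k) j)
      exact Subsingleton.elim _ _
    obtain ⟨z, hz₁, hz₂⟩ := exists_of_isPullback sq (isIso_counit_disk_f η hC le_rfl)
      (isIso_counit_zero_f η hC _) 0 w (hzero _ _ _)
    refine mem_relBoundaries.2 ⟨0, z, ?_⟩
    rw [map_zero, zero_add]
    refine sub_eq_zero.1 (eq_zero_of_isPullback sq (isIso_counit_disk_f η hC (by omega)) ?_ ?_)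
    · refine (map_sub (a.hom.hom.f m).hom _ _).trans (sub_eq_zero.2 (Eq.trans ?_ hy.symm))
      refine (comm_apply a.hom.hom _ _ _).trans ?_
      rw [hz₁, map_zero]
    · refine (map_sub ((unhom b).hom.f m).hom _ _).trans (sub_eq_zero.2 (Eq.trans ?_ hw))
      refine (comm_apply (unhom b).hom _ _ _).trans ?_
      rw [hz₂]
  · rw [← toDisk_f_bot_eq_zero_iff, ← h₂]
    exact (congrArg ((unhom b).hom.f m) hx).trans (map_zero _)

lemma exists_sphere_block (n : ℕ) :
    ∃ (Y' : RightComodule C) (a : Y' ⟶ Y) (f' : N ⟶ Y'), f' ≫ a = f ∧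
      (cofreeX C).pullbacks a ∧
      (∀ i < n, Function.Bijective (a.hom.hom.f i)) ∧
      (∀ i, Function.Surjective (a.hom.hom.f i)) := by
  let q : sphere k n ⟶ zero k := ObjectProperty.homMk 0
  obtain ⟨Y', a, b, sq⟩ := exists_isPullback Y q (isZero_zero.from_ Y.X)
  obtain ⟨f', h₁, -⟩ := exists_lift_of_isPullback sq f 0 (isZero_zero.eq_of_tgt _ _)
  exact ⟨Y', a, f', h₁, MorphismProperty.pullbacks_mk _ sq ⟨.sphereToZero n⟩,
    fun i hi ↦ bijective_of_isPullback sq (isIso_counit_sphere_f η hC (by omega))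
      (isIso_counit_zero_f η hC i) (isZero_sphere_X n (by omega)) (isZero_zero_X _),
    fun i ↦ surjective_of_isPullback sq (isIso_counit_zero_f η hC i) (isZero_zero_X _)⟩

section

variable {n : ℕ} {z : Y.X.obj.X n} {φ : Y.X.obj.X n ⟶ ModuleCat.of k k}
  (hφd : Y.X.obj.d (n + 1) n ≫ φ = 0)

omit η hC in
lemma comp_toSphere_eq_zero (hφf : ∀ x, φ (f.hom.hom.f n x) = 0) :
    f.hom ≫ toSphere Y.X n φ hφd = 0 := by
  refine to_sphere_hom_ext _ ?_
  ext x
  exact toSphere_f_eq_zero_iff.2 (hφf x)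

end

/-- In degree `0` the pullback of `0 ⟶ S⁰` is the kernel of `φ`, which excludes `z`. Degree `1`
stays surjective because the cofree comodule on `S⁰` vanishes there. -/
lemma exists_kill_block_zero {z : Y.X.obj.X 0} {φ : Y.X.obj.X 0 ⟶ ModuleCat.of k k}
    (hφd : Y.X.obj.d 1 0 ≫ φ = 0) (hφf : ∀ x, φ (f.hom.hom.f 0 x) = 0)
    (hz : z ∈ relCycles f.hom.hom 0) (hφz : φ z ≠ 0) :
    ∃ (Y' : RightComodule C) (a : Y' ⟶ Y) (f' : N ⟶ Y'), f' ≫ a = f ∧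
      (cofreeX C).pullbacks a ∧ homDim f'.hom.hom 0 < homDim f.hom.hom 0 := by
  let q : zero k ⟶ sphere k 0 := ObjectProperty.homMk 0
  obtain ⟨Y', a, b, sq⟩ := exists_isPullback Y q (toSphere Y.X 0 φ hφd)
  obtain ⟨f', h₁, -⟩ := exists_lift_of_isPullback sq f 0
    (by rw [comp_toSphere_eq_zero f hφd hφf, zero_comp])
  have h₁' : f'.hom.hom ≫ a.hom.hom = f.hom.hom :=
    congrArg (fun f ↦ f.hom.hom) h₁
  have hzero (u : (zero k).obj.X 0) : u = 0 := by
    have := ModuleCat.subsingleton_of_isZero (isZero_zero_X (k := k) 0)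
    exact Subsingleton.elim _ _
  refine ⟨Y', a, f', h₁, MorphismProperty.pullbacks_mk _ sq ⟨.zeroToSphere⟩, ?_⟩
  refine homDim_lt h₁' Y.X.property Y'.X.property ?_ ?_ hz ?_
  · refine (injective_iff_map_eq_zero (a.hom.hom.f 0).hom).2 (fun y hy ↦ ?_)
    exact eq_zero_of_isPullback sq (isIso_counit_zero_f η hC 0) hy (hzero _)
  · exact surjective_of_isPullback sq (isIso_counit_sphere_f η hC le_rfl)
      (isZero_sphere_X 0 (by simp))
  · rintro y - rfl
    have h₂ := congrArg (fun f ↦ f.hom.f 0 y) (unhom_comp_eq sq)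
    refine hφz ((toSphere_f_eq_zero_iff (h := hφd)).1 (h₂.symm.trans ?_))
    exact (congrArg (q.hom.f 0) (hzero _)).trans (map_zero (q.hom.f 0).hom)

omit [ComonObj C] η hC in
lemma bijective_diskToSphere_f (m : ℕ) :
    Function.Bijective ((diskToSphere k m).hom.f (m + 1)) := by
  rw [diskToSphere_f]
  exact (ConcreteCategory.isIso_iff_bijective _).1 inferInstance

omit [ComonObj C] η hC in
lemma exists_smul_eq_disk {m : ℕ} {v : (disk k m).obj.X m} (hv : v ≠ 0) (c : (disk k m).obj.X m) :
    ∃ r : k, r • v = c := by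
  refine exists_smul_eq_of_finrank_eq_one ?_ hv c
  rw [(diskBot k m).toLinearEquiv.finrank_eq]
  exact Module.finrank_self k

/-! ### The pullback of the cofree disk-to-sphere map near degree `m` -/

section

variable {m : ℕ} {φ : Y.X.obj.X (m + 1) ⟶ ModuleCat.of k k}
  {hφd : Y.X.obj.d (m + 2) (m + 1) ≫ φ = 0} {Y' : RightComodule C} {a : Y' ⟶ Y}
  {b : Y' ⟶ (RightComodule.cofree C).obj (disk k m)}
  (sq : IsPullback b a ((RightComodule.cofree C).map (diskToSphere k m))
    (Y.homMk (toSphere Y.X (m + 1) φ hφd)))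

include sq

lemma bijective_f_of_lt {i : ℕ} (hi : i < m) : Function.Bijective (a.hom.hom.f i) :=
  bijective_of_isPullback sq (isIso_counit_disk_f η hC (by omega))
    (isIso_counit_sphere_f η hC (by omega)) (isZero_disk_X m (by omega) (by omega))
    (isZero_sphere_X _ (by omega))

lemma surjective_f_of_le {i : ℕ} (hi : i ≤ m) : Function.Surjective (a.hom.hom.f i) :=
  surjective_of_isPullback sq (isIso_counit_sphere_f η hC (by omega)) (isZero_sphere_X _ (by omega))

lemma surjective_f_succ : Function.Surjective (a.hom.hom.f (m + 1)) := by
  intro y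
  obtain ⟨d, hd⟩ := (bijective_diskToSphere_f m).2 ((toSphere Y.X (m + 1) φ hφd).hom.f (m + 1) y)
  obtain ⟨y', hy', -⟩ := exists_of_isPullback sq (isIso_counit_disk_f η hC le_rfl)
    (isIso_counit_sphere_f η hC (by omega)) y d hd.symm
  exact ⟨y', hy'⟩

omit η hC in
lemma diskToSphere_unhom (y : Y'.X.obj.X (m + 1)) :
    (diskToSphere k m).hom.f (m + 1) ((unhom b).hom.f _ y) =
      (toSphere Y.X (m + 1) φ hφd).hom.f (m + 1) (a.hom.hom.f _ y) :=
  congrArg (fun f ↦ f.hom.f (m + 1) y) (unhom_comp_eq sq)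

omit η hC in
lemma unhom_eq_zero_iff (y : Y'.X.obj.X (m + 1)) :
    (unhom b).hom.f (m + 1) y = 0 ↔ φ (a.hom.hom.f (m + 1) y) = 0 := by
  rw [← toSphere_f_eq_zero_iff (h := hφd), ← diskToSphere_unhom sq]
  exact (map_eq_zero_iff ((diskToSphere k m).hom.f (m + 1)).hom (bijective_diskToSphere_f m).1).symm

lemma injective_f_succ : Function.Injective (a.hom.hom.f (m + 1)) := by
  refine (injective_iff_map_eq_zero (a.hom.hom.f (m + 1)).hom).2 (fun y hy ↦ ?_)
  refine eq_zero_of_isPullback sq (isIso_counit_disk_f η hC le_rfl) hy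
    ((unhom_eq_zero_iff sq y).2 ?_)
  exact (congrArg φ hy).trans (map_zero φ.hom)

variable {f} {f' : N ⟶ Y'} (h₁ : f' ≫ a = f) (h₂ : f'.hom ≫ unhom b = 0)
  {z : Y.X.obj.X (m + 1)} (hz : z ∈ relCycles f.hom.hom (m + 1)) (hφz : φ z ≠ 0)

include h₁ h₂ hz hφz

/-- The pullback adds a line, the bottom of the disk, in degree `m`. If `f x = d z`, then lifting
`z` to `Y'` and forming `d z - f' x` gives an element over `0` with nonzero disk component; it spans
the new line and is a relative boundary. -/
lemma mem_relBoundaries_of_isPullback {y : Y'.X.obj.X m} (hy : a.hom.hom.f m y = 0) :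
    y ∈ relBoundaries f'.hom.hom m := by
  obtain ⟨z, rfl⟩ := surjective_f_succ η hC sq z
  obtain ⟨x, hx⟩ := mem_relCycles_succ.1 hz
  have h₀ (i : ℕ) (x : N.X.obj.X i) : a.hom.hom.f i (f'.hom.hom.f i x) = f.hom.hom.f i x :=
    congrArg (fun f ↦ f.hom.hom.f i x) h₁
  have h₂' (i : ℕ) (x : N.X.obj.X i) : (unhom b).hom.f i (f'.hom.hom.f i x) = 0 :=
    congrArg (fun f ↦ f.hom.f i x) h₂
  have hv : (unhom b).hom.f m (Y'.X.obj.d (m + 1) m z) ≠ 0 := by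
    intro h
    refine hφz ((unhom_eq_zero_iff sq z).1 ((bijective_disk_d m).1 ?_))
    rw [map_zero, ← h, comm_apply]
  obtain ⟨r, hr⟩ := exists_smul_eq_disk hv ((unhom b).hom.f m y)
  let u := Y'.X.obj.d (m + 1) m z - f'.hom.hom.f m x
  have hu₁ : (a.hom.hom.f m).hom u = 0 := by
    refine (map_sub (a.hom.hom.f m).hom _ _).trans (sub_eq_zero.2 ?_)
    exact (comm_apply a.hom.hom _ _ z).trans (hx.symm.trans (h₀ m x).symm)
  have hu₂ : ((unhom b).hom.f m).hom u = (unhom b).hom.f m (Y'.X.obj.d (m + 1) m z) := by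
    refine (map_sub ((unhom b).hom.f m).hom _ _).trans ?_
    exact (congrArg (_ - ·) (h₂' m x)).trans (sub_zero _)
  have hy' : y = r • u := by
    refine sub_eq_zero.1 (eq_zero_of_isPullback sq (isIso_counit_disk_f η hC (by omega)) ?_ ?_)
    · refine (map_sub (a.hom.hom.f m).hom _ _).trans (sub_eq_zero.2 ?_)
      refine Eq.trans hy (Eq.symm ?_)
      rw [map_smul, hu₁, smul_zero]
    · refine (map_sub ((unhom b).hom.f m).hom _ _).trans (sub_eq_zero.2 ?_)
      rw [map_smul, hu₂]
      exact hr.symm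
  rw [hy']
  refine Submodule.smul_mem _ _ (mem_relBoundaries.2 ⟨-x, z, ?_⟩)
  rw [map_neg, neg_add_eq_sub]

-- A lift of `z` has a differential with nonzero disk component, since `φ z ≠ 0`, whereas the image
-- of `f'` has zero disk component.
omit η hC h₁ hz in
lemma apply_ne_of_mem_relCycles {y : Y'.X.obj.X (m + 1)}
    (hy : y ∈ relCycles f'.hom.hom (m + 1)) : a.hom.hom.f (m + 1) y ≠ z := by
  rintro rfl
  obtain ⟨x, hx⟩ := mem_relCycles_succ.1 hy
  refine hφz ((unhom_eq_zero_iff sq y).1 ((bijective_disk_d m).1 ?_))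
  rw [← comm_apply, ← hx, map_zero]
  exact congrArg (fun f ↦ f.hom.f m x) h₂

end

/-- Degree `m + 1` is unchanged but loses the relative cycle `z`. Degree `m` gains one line, spanned
by a relative boundary, so no relative homology appears below. -/
lemma exists_kill_block_succ {m : ℕ} {z : Y.X.obj.X (m + 1)}
    {φ : Y.X.obj.X (m + 1) ⟶ ModuleCat.of k k}
    (hφd : Y.X.obj.d (m + 2) (m + 1) ≫ φ = 0) (hφf : ∀ x, φ (f.hom.hom.f (m + 1) x) = 0)
    (hz : z ∈ relCycles f.hom.hom (m + 1)) (hφz : φ z ≠ 0) :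
    ∃ (Y' : RightComodule C) (a : Y' ⟶ Y) (f' : N ⟶ Y'), f' ≫ a = f ∧
      (cofreeX C).pullbacks a ∧
      (∀ i < m, Function.Bijective (a.hom.hom.f i)) ∧
      (∀ i ≤ m, homDim f'.hom.hom i = homDim f.hom.hom i) ∧
      homDim f'.hom.hom (m + 1) < homDim f.hom.hom (m + 1) := by
  obtain ⟨Y', a, b, sq⟩ := exists_isPullback Y (diskToSphere k m)
    (toSphere Y.X (m + 1) φ hφd)
  obtain ⟨f', h₁, h₂⟩ := exists_lift_of_isPullback sq f 0
    (by rw [comp_toSphere_eq_zero f hφd hφf, zero_comp])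
  have h₁' : f'.hom.hom ≫ a.hom.hom = f.hom.hom :=
    congrArg (fun f ↦ f.hom.hom) h₁
  have hbij (i : ℕ) (hi : i < m) : Function.Bijective (a.hom.hom.f i) :=
    bijective_f_of_lt η hC sq hi
  refine ⟨Y', a, f', h₁, MorphismProperty.pullbacks_mk _ sq ⟨.diskToSphere m⟩,
    hbij, fun i hi ↦ ?_, ?_⟩
  · obtain hi' | rfl : i < m ∨ i = m := by omega
    · exact homDim_eq_of_bijective h₁' Y'.X.property (fun j hj ↦ hbij j (by omega))
        (surjective_f_of_le η hC sq (by omega))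
    · exact homDim_eq h₁' Y'.X.property (fun j hj ↦ (hbij j hj).1)
        (surjective_f_of_le η hC sq le_rfl) (surjective_f_succ η hC sq)
        (fun y hy ↦ mem_relBoundaries_of_isPullback η hC sq h₁ h₂ hz hφz hy)
  · exact homDim_lt h₁' Y.X.property Y'.X.property (injective_f_succ η hC sq)
      (surjective_of_isPullback sq (isIso_counit_sphere_f η hC le_rfl)
        (isZero_sphere_X _ (by omega))) hz
      (fun y hy ↦ apply_ne_of_mem_relCycles sq h₂ hφz hy)

lemma exists_kill_block {n : ℕ} (hn : homDim f.hom.hom n ≠ 0) :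
    ∃ (Y' : RightComodule C) (a : Y' ⟶ Y) (f' : N ⟶ Y'), f' ≫ a = f ∧
      (cofreeX C).pullbacks a ∧
      (∀ i, i + 1 < n → Function.Bijective (a.hom.hom.f i)) ∧
      (∀ i < n, homDim f'.hom.hom i = homDim f.hom.hom i) ∧
      homDim f'.hom.hom n < homDim f.hom.hom n := by
  obtain ⟨z, hz, hzB⟩ : ∃ z ∈ relCycles f.hom.hom n, z ∉ relBoundaries f.hom.hom n := by
    have := (homDim_eq_zero_iff Y.X.property).not.1 hn
    exact Set.not_subset.1 this
  -- Vanishing on boundaries makes `φ` a chain map to a sphere; vanishing on the image of `f` lets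
  -- `f` lift with zero second component.
  obtain ⟨φ, hφz, hφ⟩ := Submodule.exists_le_ker_of_notMem hzB
  have hφd : Y.X.obj.d (n + 1) n ≫ ModuleCat.ofHom φ = 0 := by
    ext y
    refine hφ (mem_relBoundaries.2 ⟨0, y, ?_⟩)
    rw [map_zero, zero_add]
    rfl
  have hφf (x : N.X.obj.X n) : ModuleCat.ofHom φ (f.hom.hom.f n x) = 0 :=
    hφ (mem_relBoundaries.2 ⟨x, 0, by rw [map_zero, add_zero]⟩)
  obtain _ | m := n
  · obtain ⟨Y', a, f', h₁, h₂, h₃⟩ := exists_kill_block_zero η hC f hφd hφf hz hφz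
    exact ⟨Y', a, f', h₁, h₂, by simp, by simp, h₃⟩
  · obtain ⟨Y', a, f', h₁, h₂, h₃, h₄, h₅⟩ := exists_kill_block_succ η hC f hφd hφf hz hφz
    exact ⟨Y', a, f', h₁, h₂, fun i hi ↦ h₃ i (by omega), fun i hi ↦ h₄ i (by omega), h₅⟩

/-- Kernel corrections are two pullbacks, so this single one is padded with a sphere of degree `n +
1`, which is too high to affect relative homology up to degree `n`. -/
lemma exists_double_kill_block {n : ℕ} (hn : homDim f.hom.hom n ≠ 0) :
    ∃ (Y' : RightComodule C) (a : Y' ⟶ Y) (f' : N ⟶ Y'), f' ≫ a = f ∧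
      (cofreeX C).twoPullbacks a ∧
      (∀ i, i + 1 < n → Function.Bijective (a.hom.hom.f i)) ∧
      (∀ i < n, homDim f'.hom.hom i = homDim f.hom.hom i) ∧
      homDim f'.hom.hom n < homDim f.hom.hom n := by
  obtain ⟨Y', a, f', h₁, h₂, h₃, h₄, h₅⟩ := exists_kill_block η hC f hn
  obtain ⟨Y'', b, f'', h₁', h₂', h₃', h₄'⟩ := exists_sphere_block η hC f' (n + 1)
  have h (i : ℕ) (hi : i ≤ n) : homDim f''.hom.hom i = homDim f'.hom.hom i :=
    homDim_eq_of_bijective (a := b.hom.hom) (congrArg (fun f ↦ f.hom.hom) h₁') Y''.X.property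
      (fun j hj ↦ h₃' j (by omega)) (h₄' _)
  refine ⟨Y'', b ≫ a, f'', by rw [← Category.assoc, h₁', h₁], ⟨_, b, a, h₂', h₂, rfl⟩,
    fun i hi ↦ ?_, fun i hi ↦ by rw [h i hi.le, h₄ i hi], by rwa [h n le_rfl]⟩
  exact (h₃ i hi).comp (h₃' i (by omega))

end

end FinTypeCh

/-! ## Factorizations through towers -/

/-- A process which, in each state, lowers the first nonzero value of `μ` without changing the
zeros before it makes all values of `μ` eventually zero. -/
lemma exists_process {S : Type*} (μ : S → ℕ → ℕ) (R : ℕ → S → S → Prop)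
    (h₁ : ∀ s n, μ s n ≠ 0 → (∀ i < n, μ s i = 0) →
      ∃ s', R n s s' ∧ (∀ i < n, μ s' i = 0) ∧ μ s' n < μ s n)
    (h₂ : ∀ s n, (∀ i < n, μ s i = 0) → ∃ s', R n s s' ∧ ∀ i < n, μ s' i = 0) (s₀ : S) :
    ∃ (s : ℕ → S) (l : ℕ → ℕ), s 0 = s₀ ∧ (∀ t, R (l t) (s t) (s (t + 1))) ∧
      ∀ n, ∃ T, ∀ t ≥ T, n ≤ l t ∧ μ (s t) n = 0 := by
  -- Work at the least nonzero value of `μ`. If there is none, idle at level `t`, which forces the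
  -- levels to infinity in that case as well.
  have key (s : S) (t : ℕ) : ∃ (s' : S) (n : ℕ), R n s s' ∧ (∀ i < n, μ s i = 0) ∧
      (∀ i < n, μ s' i = 0) ∧ (μ s' n < μ s n ∨ t ≤ n) := by
    by_cases h : ∃ n, μ s n ≠ 0
    · classical
      have hlt : ∀ i < Nat.find h, μ s i = 0 := fun i hi ↦ not_not.1 (Nat.find_min h hi)
      obtain ⟨s', h₁, h₂, h₃⟩ := h₁ s _ (Nat.find_spec h) hlt
      exact ⟨s', _, h₁, hlt, h₂, Or.inl h₃⟩
    · push Not at h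
      obtain ⟨s', h₁, h₂⟩ := h₂ s t (fun i _ ↦ h i)
      exact ⟨s', t, h₁, fun i _ ↦ h i, h₂, Or.inr le_rfl⟩
  choose next level hR hlevel hnext hlt using key
  let s (t : ℕ) : S := Nat.rec s₀ (fun t s ↦ next s t) t
  refine ⟨s, fun t ↦ level (s t) t, rfl, fun t ↦ hR _ _, ?_⟩
  have hzero (n : ℕ) : ∃ T, ∀ t ≥ T, ∀ i < n, μ (s t) i = 0 := by
    induction n with
    | zero => exact ⟨0, by simp⟩
    | succ n hn =>
      obtain ⟨T, hT⟩ := hn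
      -- Once the values below `n` vanish for good, a step either lowers the value at `n` or happens
      -- above `n`; the latter means that the value at `n` is already zero.
      have hle (t : ℕ) (ht : max T (n + 1) ≤ t) :
          μ (s (t + 1)) n < μ (s t) n ∨ n < level (s t) t := by
        by_cases hn' : n < level (s t) t
        · exact Or.inr hn'
        · refine Or.inl ?_
          obtain h | h := hlt (s t) t
          · obtain hlt' | heq : level (s t) t < n ∨ level (s t) t = n := by omega
            · rw [hT t (by omega) _ hlt'] at h
              omega
            · rwa [heq] at h
          · omega
      have hle' (t : ℕ) (ht : max T (n + 1) ≤ t) (h : μ (s t) n = 0) : μ (s (t + 1)) n = 0 := by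
        obtain h' | h' := hle t ht
        · omega
        · exact hnext (s t) t n h'
      have hex (m : ℕ) : ∀ t ≥ max T (n + 1), μ (s t) n ≤ m → ∃ t' ≥ t, μ (s t') n = 0 := by
        induction m with
        | zero => exact fun t _ h ↦ ⟨t, le_rfl, by omega⟩
        | succ m hm =>
          intro t ht h
          obtain h' | h' := hle t ht
          · obtain ⟨t', h₁, h₂⟩ := hm (t + 1) (by omega) (by omega)
            exact ⟨t', by omega, h₂⟩
          · exact ⟨t + 1, by omega, hnext (s t) t n h'⟩
      obtain ⟨T', h₁, h₂⟩ := hex _ (max T (n + 1)) le_rfl le_rfl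
      refine ⟨T', fun t ht i hi ↦ ?_⟩
      obtain hi' | rfl : i < n ∨ i = n := by omega
      · exact hT t (by omega) i hi'
      · induction t, ht using Nat.le_induction with
        | base => exact h₂
        | succ t ht ih => exact hle' t (by omega) ih
  intro n
  obtain ⟨T, hT⟩ := hzero (n + 1)
  refine ⟨max T n, fun t ht ↦ ⟨?_, hT t (by omega) n (by omega)⟩⟩
  obtain h | h := hlt (s t) t
  · change n ≤ level (s t) t
    by_contra! hn
    rw [hT t (by omega) _ (by omega)] at h
    omega
  · exact (le_max_right _ _).trans (le_trans ht h)

namespace FinTypeCh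

open Limits ChainComplex Opposite

variable {k : Type u} [Field k] {C : FinTypeCh k} [ComonObj C]

/-- The projections from the limits of degreewise stable towers of morphisms in `Q`. -/
inductive stableTowers (Q : MorphismProperty (RightComodule C)) :
    MorphismProperty (RightComodule C)
  | mk (X : ℕ → RightComodule C) (a : ∀ n, X (n + 1) ⟶ X n) (ha : ∀ n, Q (a n))
      (c : Cone (Functor.ofOpSequence a)) (hc : IsLimit c)
      (hs : ∀ n, ∃ j, ∀ i ≤ n, Function.Bijective ((c.π.app (op j)).hom.hom.f i)) :
      stableTowers Q (c.π.app (op 0))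

lemma stableTowers_pullbacks_le (W : MorphismProperty (RightComodule C)) :
    stableTowers W.pullbacks ≤ postnikovTowers.{w} W := by
  rintro _ _ _ ⟨X, a, ha, c, hc, -⟩
  exact postnikovTowers_of_isLimit a ha hc

lemma stableTowers_twoPullbacks_le (W : MorphismProperty (RightComodule C)) :
    stableTowers W.twoPullbacks ≤ postnikovTowers.{w} W := by
  rintro _ _ _ ⟨X, a, ha, c, hc, -⟩
  choose Z p q hp hq h using ha
  obtain rfl : (fun n ↦ p n ≫ q n) = a := funext h
  exact postnikovTowers_of_isLimit_comp p q hp hq hc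

lemma cone_app_ofOpSequence {X : ℕ → RightComodule C} {a : ∀ n, X (n + 1) ⟶ X n}
    (c : Cone (Functor.ofOpSequence a)) (n : ℕ) :
    c.π.app (op (n + 1)) ≫ a n = c.π.app (op n) := by
  have := c.w (homOfLE (Nat.le_add_right n 1)).op
  rw [Functor.ofOpSequence_map_homOfLE_succ] at this
  exact this

/-- For each `n`, the projection to a late stage is bijective through degree `n + 1`, hence a
quasi-isomorphism at `n`. Only finitely many steps of the tower remain to be composed. -/
lemma quasiIso_of_stableTowers {Q : MorphismProperty (RightComodule C)}
    (hQ : ∀ ⦃X Y : RightComodule C⦄ (f : X ⟶ Y), Q f → QuasiIso f.hom.hom)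
    {X Y : RightComodule C} {f : X ⟶ Y} (hf : stableTowers Q f) : QuasiIso f.hom.hom := by
  obtain ⟨X, a, ha, c, hc, hs⟩ := hf
  refine ⟨fun n ↦ ?_⟩
  obtain ⟨j, hj⟩ := hs (n + 1)
  have h₁ : QuasiIsoAt (c.π.app (op j)).hom.hom n :=
    quasiIsoAt_of_bijective (fun i hi ↦ hj i (by omega)) (hj (n + 1) le_rfl).2
  clear hj
  induction j with
  | zero => exact h₁
  | succ j hj =>
    refine hj ?_
    have h₂ : (c.π.app (op j)).hom.hom = (c.π.app (op (j + 1))).hom.hom ≫ (a j).hom.hom :=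
      congrArg (fun f ↦ f.hom.hom) (cone_app_ofOpSequence c j).symm
    have h₃ : QuasiIso (a j).hom.hom := hQ _ (ha j)
    rw [h₂]
    have : QuasiIsoAt (K := ((Functor.ofOpSequence a).obj (op (j + 1))).X.obj)
      (L := ((Functor.ofOpSequence a).obj (op j)).X.obj) (a j).hom.hom n := h₃.quasiIsoAt n
    exact quasiIsoAt_comp _ _ n

lemma isEventuallyConstantTo_ofOpSequence {X : ℕ → RightComodule C} {a : ∀ n, X (n + 1) ⟶ X n}
    {n T : ℕ} (h : ∀ t ≥ T, Function.Bijective ((a t).hom.hom.f n)) :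
    ((Functor.ofOpSequence a ⋙ RightComodule.forget C) ⋙ eval k n).IsEventuallyConstantTo
      (op T) := by
  suffices ∀ (b : ℕ) (hb : T ≤ b), IsIso (((Functor.ofOpSequence a ⋙ RightComodule.forget C) ⋙
      eval k n).map (homOfLE hb).op) from fun ⟨b⟩ f ↦ this b (leOfHom f.unop)
  intro b hb
  induction b, hb using Nat.le_induction with
  | base =>
    rw [show (homOfLE (le_refl T)).op = 𝟙 _ from rfl, CategoryTheory.Functor.map_id]
    infer_instance
  | succ b hb ih =>
    have h₁ : (homOfLE (le_trans hb (Nat.le_add_right b 1))).op =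
      (homOfLE (Nat.le_add_right b 1)).op ≫ (homOfLE hb).op := rfl
    have h₂ : IsIso (((Functor.ofOpSequence a ⋙ RightComodule.forget C) ⋙ eval k n).map
        (homOfLE (Nat.le_add_right b 1)).op) := by
      have h₃ : IsIso ((a b).hom.hom.f n) := (ConcreteCategory.isIso_iff_bijective _).2 (h b hb)
      dsimp only [Functor.comp_map]
      rw [Functor.ofOpSequence_map_homOfLE_succ]
      exact h₃
    rw [h₁, Functor.map_comp]
    infer_instance

lemma exists_isLimit_ofOpSequence (X : ℕ → RightComodule C) (a : ∀ n, X (n + 1) ⟶ X n)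
    (h : ∀ n, ∃ T, ∀ t ≥ T, Function.Bijective ((a t).hom.hom.f n)) :
    ∃ (c : Cone (Functor.ofOpSequence a)) (_ : IsLimit c), ∀ T n,
      (∀ t ≥ T, Function.Bijective ((a t).hom.hom.f n)) →
        Function.Bijective ((c.π.app (op T)).hom.hom.f n) := by
  have hD : IsStableTower (Functor.ofOpSequence a ⋙ RightComodule.forget C) := fun n ↦ by
    obtain ⟨T, hT⟩ := h n
    exact ⟨T, isEventuallyConstantTo_ofOpSequence hT⟩
  obtain ⟨c, hc, hπ⟩ := exists_isLimit_comodule hD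
  exact ⟨c, hc, fun T n hT ↦ (ConcreteCategory.isIso_iff_bijective _).1
    (hπ n T (isEventuallyConstantTo_ofOpSequence hT))⟩

lemma exists_lift_ofOpSequence {X : ℕ → RightComodule C} {a : ∀ n, X (n + 1) ⟶ X n}
    {c : Cone (Functor.ofOpSequence a)} (hc : IsLimit c) {N : RightComodule C}
    (f : ∀ n, N ⟶ X n) (hf : ∀ n, f (n + 1) ≫ a n = f n) :
    ∃ g : N ⟶ c.pt, ∀ n, g ≫ c.π.app (op n) = f n := by
  let d : Cone (Functor.ofOpSequence a) :=
    { pt := N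
      π := NatTrans.ofOpSequence f (fun n ↦ by
        rw [Functor.ofOpSequence_map_homOfLE_succ]
        exact (Category.id_comp _).trans (hf n).symm) }
  exact ⟨hc.lift d, fun n ↦ hc.fac d (op n)⟩

/-- Here `μ` is a defect to be made zero, applied to `kerDim` and to `kerDim + homDim`. The levels
tend to infinity, so each degree is altered finitely often, and `hμ` carries the vanishing of `μ`
from late stages to the limit. -/
lemma exists_stableTowers_fac {N : RightComodule C} (Q : MorphismProperty (RightComodule C))
    (μ : ∀ {Y : RightComodule C}, (N ⟶ Y) → ℕ → ℕ)
    (hμ : ∀ {Y Y' : RightComodule C} {f : N ⟶ Y} {f' : N ⟶ Y'} {a : Y' ⟶ Y} (n : ℕ), f' ≫ a = f →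
      (∀ i ≤ n + 1, Function.Bijective (a.hom.hom.f i)) → μ f' n = μ f n)
    (h₁ : ∀ {Y : RightComodule C} (f : N ⟶ Y) (n : ℕ), μ f n ≠ 0 → (∀ i < n, μ f i = 0) →
      ∃ (Y' : RightComodule C) (a : Y' ⟶ Y) (f' : N ⟶ Y'), f' ≫ a = f ∧ Q a ∧
        (∀ i, i + 1 < n → Function.Bijective (a.hom.hom.f i)) ∧ (∀ i < n, μ f' i = 0) ∧
        μ f' n < μ f n)
    (h₂ : ∀ {Y : RightComodule C} (f : N ⟶ Y) (n : ℕ), (∀ i < n, μ f i = 0) →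
      ∃ (Y' : RightComodule C) (a : Y' ⟶ Y) (f' : N ⟶ Y'), f' ≫ a = f ∧ Q a ∧
        (∀ i, i + 1 < n → Function.Bijective (a.hom.hom.f i)) ∧ ∀ i < n, μ f' i = 0)
    {Y : RightComodule C} (f : N ⟶ Y) :
    ∃ (Z : RightComodule C) (i : N ⟶ Z) (p : Z ⟶ Y), i ≫ p = f ∧ (∀ n, μ i n = 0) ∧
      stableTowers Q p := by
  let S := Σ Y : RightComodule C, N ⟶ Y
  let R (n : ℕ) (s s' : S) : Prop := ∃ a : s'.1 ⟶ s.1, s'.2 ≫ a = s.2 ∧ Q a ∧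
    ∀ i, i + 1 < n → Function.Bijective (a.hom.hom.f i)
  suffices ∀ s₀ : S, ∃ (Z : RightComodule C) (i : N ⟶ Z) (p : Z ⟶ s₀.1), i ≫ p = s₀.2 ∧
      (∀ n, μ i n = 0) ∧ stableTowers Q p from this ⟨Y, f⟩
  intro s₀
  obtain ⟨s, l, rfl, hR, hs⟩ := exists_process (S := S) (fun s ↦ μ s.2) R
    (fun s n hn hn' ↦ by
      obtain ⟨Y', a, f', h₁, h₂, h₃, h₄, h₅⟩ := h₁ s.2 n hn hn'
      exact ⟨⟨Y', f'⟩, ⟨a, h₁, h₂, h₃⟩, h₄, h₅⟩)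
    (fun s n hn ↦ by
      obtain ⟨Y', a, f', h₁, h₂, h₃, h₄⟩ := h₂ s.2 n hn
      exact ⟨⟨Y', f'⟩, ⟨a, h₁, h₂, h₃⟩, h₄⟩) s₀
  choose a ha hQ hbij using hR
  have hconst (n : ℕ) : ∃ T, μ (s T).2 n = 0 ∧
      ∀ i ≤ n + 1, ∀ t ≥ T, Function.Bijective ((a t).hom.hom.f i) := by
    obtain ⟨T₁, h₁⟩ := hs n
    -- A step at level `l` is bijective in degrees `i` with `i + 1 < l`, and degrees up to `n + 1`
    -- are required.
    obtain ⟨T₂, h₂⟩ := hs (n + 3)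
    refine ⟨max T₁ T₂, (h₁ _ (le_max_left _ _)).2, fun i hi t ht ↦ hbij t i ?_⟩
    have := (h₂ t (le_trans (le_max_right _ _) ht)).1
    omega
  obtain ⟨c, hc, hπ⟩ := exists_isLimit_ofOpSequence (fun n ↦ (s n).1) a (fun n ↦ by
    obtain ⟨T, -, hT⟩ := hconst n
    exact ⟨T, hT n (by omega)⟩)
  obtain ⟨i, hi⟩ := exists_lift_ofOpSequence hc (fun n ↦ (s n).2) ha
  refine ⟨c.pt, i, c.π.app (op 0), hi 0, fun n ↦ ?_,
    stableTowers.mk (fun n ↦ (s n).1) a hQ c hc (fun n ↦ ?_)⟩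
  · obtain ⟨T, h₁, h₂⟩ := hconst n
    exact (hμ n (hi T) (fun i hi ↦ hπ T i (h₂ i hi))).trans h₁
  · obtain ⟨T, -, hT⟩ := hconst n
    exact ⟨T, fun i hi ↦ hπ T i (hT i (by omega))⟩

section

variable (η : Coaugmentation C) (hC : IsOneConnected C)

include η hC

lemma exists_fac_cofreeZ {N Y : RightComodule C} (f : N ⟶ Y) :
    ∃ (Z : RightComodule C) (i : N ⟶ Z) (p : Z ⟶ Y), i ≫ p = f ∧
      (∀ n, Function.Injective (i.hom.hom.f n)) ∧ QuasiIso p.hom.hom ∧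
      postnikovTowers.{w} (cofreeZ C) p := by
  have H := exists_stableTowers_fac
    (fun X Y a ↦ (cofreeZ C).pullbacks a ∧ QuasiIso a.hom.hom)
    (fun {Y} (f : N ⟶ Y) n ↦ kerDim f.hom.hom n)
    (fun n h ha ↦ kerDim_eq_of_injective (congrArg (fun f ↦ f.hom.hom) h) (ha n (by omega)).1)
    (fun {Y} f n hn hn' ↦ ?_) (fun {Y} f n hn ↦ ?_) f
  · obtain ⟨Z, i, p, h₁, h₂, h₃⟩ := H
    refine ⟨Z, i, p, h₁, fun n ↦ (kerDim_eq_zero_iff N.X.property).1 (h₂ n),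
      quasiIso_of_stableTowers (fun _ _ _ h ↦ h.2) h₃, stableTowers_pullbacks_le _ _ ?_⟩
    obtain ⟨X, a, ha, c, hc, hs⟩ := h₃
    exact ⟨X, a, fun n ↦ (ha n).1, c, hc, hs⟩
  · obtain ⟨x, hx, hx'⟩ : ∃ x : N.X.obj.X n, f.hom.hom.f n x = 0 ∧ x ≠ 0 := by
      have := (kerDim_eq_zero_iff N.X.property).not.1 hn
      by_contra! h
      exact this ((injective_iff_map_eq_zero (f.hom.hom.f n).hom).2 h)
    obtain ⟨ψ, hψ, -⟩ := Submodule.exists_le_ker_of_notMem (p := (⊥ : Submodule k _)) hx'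
    obtain ⟨Y', a, f', h₁, h₂, -, h₃, h₄, -, -, h₅⟩ :=
      exists_disk_block η hC f n (ModuleCat.ofHom ψ)
    have h₁' : f'.hom.hom ≫ a.hom.hom = f.hom.hom := congrArg (fun f ↦ f.hom.hom) h₁
    refine ⟨Y', a, f', h₁, ⟨h₂, h₃⟩, fun i hi ↦ h₄ i (by omega), fun i hi ↦ ?_, ?_⟩
    · exact (kerDim_eq_of_injective h₁' (h₄ i hi).1).trans (hn' i hi)
    · exact kerDim_lt N.X.property h₁' hx (fun h ↦ hψ (h₅ x h))
  · obtain ⟨Y', a, f', h₁, h₂, -, h₃, h₄, -⟩ := exists_disk_block η hC f n 0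
    have h₁' : f'.hom.hom ≫ a.hom.hom = f.hom.hom := congrArg (fun f ↦ f.hom.hom) h₁
    exact ⟨Y', a, f', h₁, ⟨h₂, h₃⟩, fun i hi ↦ h₄ i (by omega),
      fun i hi ↦ (kerDim_eq_of_injective h₁' (h₄ i hi).1).trans (hn i hi)⟩

lemma exists_fac_cofreeX {N Y : RightComodule C} (f : N ⟶ Y) :
    ∃ (Z : RightComodule C) (i : N ⟶ Z) (p : Z ⟶ Y), i ≫ p = f ∧
      (∀ n, Function.Injective (i.hom.hom.f n)) ∧ QuasiIso i.hom.hom ∧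
      postnikovTowers.{w} (cofreeX C) p := by
  -- A disk at level `n` keeps the lower defects zero. For `i = n - 1` the boundaries come from
  -- degree `n`, where surjectivity is enough.
  have hzero {Y Y' : RightComodule C} {f : N ⟶ Y} {f' : N ⟶ Y'} {a : Y' ⟶ Y} (h₁ : f' ≫ a = f)
      {n i : ℕ} (hi : i < n) (ha : ∀ i < n, Function.Bijective (a.hom.hom.f i))
      (ha' : Function.Surjective (a.hom.hom.f n))
      (hn : kerDim f.hom.hom i + homDim f.hom.hom i = 0) :
      kerDim f'.hom.hom i + homDim f'.hom.hom i = 0 := by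
    have h₁' : f'.hom.hom ≫ a.hom.hom = f.hom.hom := congrArg (fun f ↦ f.hom.hom) h₁
    rw [kerDim_eq_of_injective h₁' (ha i hi).1, homDim_eq_of_bijective h₁' Y'.X.property
      (fun j hj ↦ ha j (by omega)), hn]
    obtain h | rfl : i + 1 < n ∨ i + 1 = n := by omega
    exacts [(ha _ h).2, ha']
  have H := exists_stableTowers_fac (cofreeX C).twoPullbacks
    (fun {Y} (f : N ⟶ Y) n ↦ kerDim f.hom.hom n + homDim f.hom.hom n)
    (fun {Y Y' f f' a} n h ha ↦ ?_)
    (fun {Y} f n hn hn' ↦ ?_) (fun {Y} f n hn ↦ ?_) f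
  · obtain ⟨Z, i, p, h₁, h₂, h₃⟩ := H
    have hi (n : ℕ) : Function.Injective (i.hom.hom.f n) :=
      (kerDim_eq_zero_iff N.X.property).1 (Nat.add_eq_zero_iff.1 (h₂ n)).1
    exact ⟨Z, i, p, h₁, hi, (quasiIso_iff_relCycles_le hi).2
      (fun n ↦ (homDim_eq_zero_iff Z.X.property).1 (Nat.add_eq_zero_iff.1 (h₂ n)).2),
      stableTowers_twoPullbacks_le _ _ h₃⟩
  · have h' : f'.hom.hom ≫ a.hom.hom = f.hom.hom := congrArg (fun f ↦ f.hom.hom) h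
    exact congrArg₂ (· + ·) (kerDim_eq_of_injective h' (ha n (by omega)).1)
      (homDim_eq_of_bijective h' Y'.X.property (fun i hi ↦ ha i (by omega)) (ha _ le_rfl).2)
  -- The kernel in degree `n` is removed before the homology: disks do not change `homDim` in that
  -- degree, and later corrections keep injectivity, as `f'` is the first factor of an injective
  -- map.
  · by_cases hker : kerDim f.hom.hom n = 0
    · obtain ⟨Y', a, f', h₁, h₂, h₃, h₄, h₅⟩ := exists_double_kill_block η hC f (n := n) (by omega)
      have h₁' : f'.hom.hom ≫ a.hom.hom = f.hom.hom := congrArg (fun f ↦ f.hom.hom) h₁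
      have hinj (i : ℕ) (hi : i ≤ n) : kerDim f'.hom.hom i = 0 := by
        refine (kerDim_eq_zero_iff N.X.property).2 ?_
        have : Function.Injective (f.hom.hom.f i) := (kerDim_eq_zero_iff N.X.property).1 (by
          obtain hi' | rfl : i < n ∨ i = n := by omega
          · exact (Nat.add_eq_zero_iff.1 (hn' i hi')).1
          · exact hker)
        intro x y hxy
        refine this ?_
        rw [← comp_f_apply h₁', ← comp_f_apply h₁', hxy]
      refine ⟨Y', a, f', h₁, h₂, h₃, fun i hi ↦ ?_, ?_⟩
      · have := hn' i hi
        have := hinj i hi.le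
        have := h₄ i hi
        omega
      · have := hinj n le_rfl
        omega
    · obtain ⟨x, hx, hx'⟩ : ∃ x : N.X.obj.X n, f.hom.hom.f n x = 0 ∧ x ≠ 0 := by
        have := (kerDim_eq_zero_iff N.X.property).not.1 hker
        by_contra! h
        exact this ((injective_iff_map_eq_zero (f.hom.hom.f n).hom).2 h)
      obtain ⟨ψ, hψ, -⟩ := Submodule.exists_le_ker_of_notMem (p := (⊥ : Submodule k _)) hx'
      obtain ⟨Y', a, f', h₁, -, h₂, -, h₃, h₄, h₅, h₆⟩ :=
        exists_disk_block η hC f n (ModuleCat.ofHom ψ)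
      have h₁' : f'.hom.hom ≫ a.hom.hom = f.hom.hom := congrArg (fun f ↦ f.hom.hom) h₁
      refine ⟨Y', a, f', h₁, h₂, fun i hi ↦ h₃ i (by omega),
        fun i hi ↦ hzero h₁ hi h₃ (h₄ n) (hn' i hi), ?_⟩
      have := kerDim_lt N.X.property h₁' hx (fun h ↦ hψ (h₆ x h))
      omega
  · obtain ⟨Y', a, f', h₁, -, h₂, -, h₃, h₄, -⟩ := exists_disk_block η hC f n 0
    exact ⟨Y', a, f', h₁, h₂, fun i hi ↦ h₃ i (by omega),
      fun i hi ↦ hzero h₁ hi h₃ (h₄ n) (hn i hi)⟩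

end

end FinTypeCh

/-! ## Comodules over the unit -/

namespace RightComodule

variable {M : Type u} [Category.{v} M] [MonoidalCategory M]

attribute [local instance] ComonObj.instTensorUnit

/-- An object as a comodule over the trivial comonoid. -/
def trivialComodule (K : M) : RightComodule (𝟙_ M) where
  X := K
  coact := (ρ_ K).inv
  coact_coassoc := by
    dsimp
    monoidal
  coact_counit := by simp

lemma coact_eq (N : RightComodule (𝟙_ M)) : N.coact = (ρ_ N.X).inv := by
  have := N.coact_counit
  rwa [ComonObj.instTensorUnit_counit, whiskerLeft_id, Category.comp_id] at this

/-- Every morphism between comodules over the trivial comonoid is a comodule morphism. -/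
def trivialHom {N N' : RightComodule (𝟙_ M)} (f : N.X ⟶ N'.X) : N ⟶ N' where
  hom := f
  comm := by
    rw [coact_eq, coact_eq, rightUnitor_inv_naturality]

variable (M) in
/-- The coaugmentation of the trivial comonoid. -/
def trivialCoaugmentation : Coaugmentation (𝟙_ M) where
  η := 𝟙 _
  η_counit := by simp
  η_comul := by simp

end RightComodule

/-! ## Lifting properties -/

namespace FinTypeCh

open Limits ChainComplex RightComodule

variable {k : Type u} [Field k]

lemma to_disk_hom_ext {K : FinTypeCh k} {m : ℕ} {f g : K ⟶ disk k m}
    (h : f.hom.f m = g.hom.f m) : f = g := by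
  refine ObjectProperty.hom_ext _ (HomologicalComplex.hom_ext _ _ (fun i ↦ ?_))
  by_cases h₀ : i = m + 1
  · subst h₀
    ext x
    refine (bijective_disk_d m).1 ?_
    rw [← comm_apply, ← comm_apply, h]
  by_cases h₁ : i = m
  · rw [h₁, h]
  · exact (isZero_disk_X m h₀ h₁).eq_of_tgt _ _

/-- Maps to the disk are linear forms in its bottom degree, and these extend along injections. -/
lemma diskToZero_rlp (m : ℕ) :
    (degreewiseInjections k).rlp (ObjectProperty.homMk 0 : disk k m ⟶ zero k) := by
  intro A B i hi
  obtain ⟨r, hr⟩ := LinearMap.exists_leftInverse_of_injective (i.hom.f m).hom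
    (LinearMap.ker_eq_bot.2 (hi m))
  have hr' : i.hom.f m ≫ ModuleCat.ofHom r = 𝟙 _ := ModuleCat.hom_ext hr
  refine ⟨fun {t b} _ ↦ ⟨⟨toDisk B m (ModuleCat.ofHom r ≫ t.hom.f m ≫ (diskBot k m).hom), ?_,
    isZero_zero.eq_of_tgt _ _⟩⟩⟩
  refine to_disk_hom_ext ?_
  change i.hom.f m ≫ (toDisk B m _).hom.f m = _
  rw [toDisk_f_bot]
  simp only [Category.assoc, Iso.hom_inv_id, Category.comp_id]
  rw [← Category.assoc, hr', Category.id_comp]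

lemma generatingX_le : generatingX k ≤ positiveSurjections k := by
  have hzero {K L : FinTypeCh k} (f : K ⟶ L) {n : ℕ} (h : IsZero (L.obj.X n)) :
      Function.Surjective (f.hom.f n) := fun y ↦ by
    have := ModuleCat.subsingleton_of_isZero h
    exact ⟨0, Subsingleton.elim _ _⟩
  rintro _ _ _ (m | _ | m) n hn
  · by_cases h : n = m + 1
    · subst h
      exact (bijective_diskToSphere_f m).2
    · exact hzero _ (isZero_sphere_X _ h)
  · exact hzero _ (isZero_sphere_X _ hn.ne')
  · exact hzero _ (isZero_zero_X n)

lemma positiveSurjections_le_rlp :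
    positiveSurjections k ≤ (degreewiseInjections k ⊓ quasiIsos k).rlp := by
  rintro X Y p hp A B i ⟨hi, hi'⟩
  have : QuasiIso i.hom := hi'
  refine ⟨fun {t b} sq ↦ ?_⟩
  obtain ⟨l, h₁, h₂⟩ := exists_lift_of_injective_of_quasiIso hi hp (congrArg (·.hom) sq.w)
  exact ⟨⟨⟨ObjectProperty.homMk l, ObjectProperty.hom_ext _ h₁, ObjectProperty.hom_ext _ h₂⟩⟩⟩

variable (C : FinTypeCh k) [ComonObj C]

/-- Lifting problems against a cofree map transpose along `forget ⊣ cofree` to lifting problems in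
complexes. -/
lemma strictMap_cofree_le_rlp {L W : MorphismProperty (FinTypeCh k)} (h : W ≤ L.rlp) :
    W.strictMap (RightComodule.cofree C) ≤ (L.inverseImage (RightComodule.forget C)).rlp := by
  rintro _ _ _ ⟨hp⟩ A B i hi
  exact ((RightComodule.adj C).hasLiftingProperty_iff i _).1 (h _ hp _ hi)

lemma cofreeZ_le_rlp :
    cofreeZ C ≤ ((degreewiseInjections k).inverseImage (RightComodule.forget C)).rlp :=
  strictMap_cofree_le_rlp C (by
    rintro _ _ _ ⟨m⟩
    exact diskToZero_rlp m)

lemma cofreeX_le_rlp :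
    cofreeX C ≤ ((degreewiseInjections k).inverseImage (RightComodule.forget C) ⊓
      (quasiIsos k).inverseImage (RightComodule.forget C)).rlp :=
  strictMap_cofree_le_rlp C (generatingX_le.trans positiveSurjections_le_rlp)

/-! ## The model structures -/

instance : (quasiIsos k).HasTwoOutOfThreeProperty :=
  inferInstanceAs ((HomologicalComplex.quasiIso (ModuleCat.{u} k)
    (ComplexShape.down ℕ)).inverseImage (finiteType k).ι).HasTwoOutOfThreeProperty

instance : (quasiIsos k).IsStableUnderRetracts :=
  inferInstanceAs ((HomologicalComplex.quasiIso (ModuleCat.{u} k)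
    (ComplexShape.down ℕ)).inverseImage (finiteType k).ι).IsStableUnderRetracts

instance : (degreewiseInjections k).IsStableUnderRetracts where
  of_retract {X Y X' Y' f g} h hg n x y hxy := by
    have h₁ (x : X.obj.X n) : h.r.left.hom.f n (h.i.left.hom.f n x) = x :=
      congrArg (fun f ↦ f.hom.f n x) h.retract_left
    have h₂ (x : X.obj.X n) : g.hom.f n (h.i.left.hom.f n x) = h.i.right.hom.f n (f.hom.f n x) :=
      congrArg (fun f ↦ f.hom.f n x) h.i_w
    rw [← h₁ x, ← h₁ y]
    refine congrArg _ (hg n ?_)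
    rw [h₂, h₂, hxy]

lemma hasFactorization_of_exists {D : Type*} [Category* D] {L R : MorphismProperty D}
    (h : ∀ {X Y : D} (f : X ⟶ Y), ∃ (Z : D) (i : X ⟶ Z) (p : Z ⟶ Y), i ≫ p = f ∧ L i ∧ R p) :
    MorphismProperty.HasFactorization L R where
  nonempty_mapFactorizationData f := by
    obtain ⟨Z, i, p, fac, hi, hp⟩ := h f
    exact ⟨⟨Z, i, p, fac, hi, hp⟩⟩

/-- By the retract argument every map in `L.rlp` is a retract of one in `R ⊓ W`. -/
lemma rlp_le_of_hasFactorization {D : Type*} [Category* D] {L R W : MorphismProperty D}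
    [W.IsStableUnderRetracts] (h : MorphismProperty.HasFactorization L (R ⊓ W))
    (hR : R ≤ L.rlp) : L.rlp ≤ W := by
  rw [rlp_eq_retracts_of_hasFactorization h (inf_le_left.trans hR)]
  exact MorphismProperty.retracts_le_iff.2 inf_le_right

/-- The underlying degreewise injections of comodule maps. -/
abbrev comoduleInjections : MorphismProperty (RightComodule C) :=
  (degreewiseInjections k).inverseImage (RightComodule.forget C)

/-- The underlying quasi-isomorphisms of comodule maps. -/
abbrev comoduleQuasiIsos : MorphismProperty (RightComodule C) :=
  (quasiIsos k).inverseImage (RightComodule.forget C)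

section

variable {C} (η : Coaugmentation C) (hC : IsOneConnected C)

include η hC

lemma hasFactorization_cofreeZ : MorphismProperty.HasFactorization (comoduleInjections C)
    (postnikovTowers.{w} (cofreeZ C) ⊓ comoduleQuasiIsos C) :=
  hasFactorization_of_exists (fun f ↦ by
    obtain ⟨Z, i, p, h₁, h₂, h₃, h₄⟩ := exists_fac_cofreeZ.{w} η hC f
    exact ⟨Z, i, p, h₁, h₂, h₄, h₃⟩)

lemma hasFactorization_cofreeX :
    MorphismProperty.HasFactorization (comoduleInjections C ⊓ comoduleQuasiIsos C)
      (postnikovTowers.{w} (cofreeX C)) :=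
  hasFactorization_of_exists (fun f ↦ by
    obtain ⟨Z, i, p, h₁, h₂, h₃, h₄⟩ := exists_fac_cofreeX.{w} η hC f
    exact ⟨Z, i, p, h₁, ⟨h₂, h₃⟩, h₄⟩)

end

lemma quasiIso_zero_to_disk (m : ℕ) : quasiIsos k (ObjectProperty.homMk 0 : zero k ⟶ disk k m) := by
  refine ⟨fun n ↦ ?_⟩
  have := ModuleCat.subsingleton_of_isZero (isZero_zero_X (k := k) n)
  rw [ChainComplex.quasiIsoAt_iff]
  refine ⟨fun x _ _ _ ↦ ⟨0, Subsingleton.elim _ _⟩, fun y hy ↦ ?_⟩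
  obtain ⟨y', rfl⟩ := exists_d_eq_of_homotopy (diskHomotopy m) hy
  exact ⟨0, y', isCycle_zero _ _, by rw [map_zero, zero_add]⟩

lemma exists_hom_from_disk (K : FinTypeCh k) {m : ℕ} (y : K.obj.X (m + 1)) :
    ∃ (f : disk k m ⟶ K) (x : (disk k m).obj.X (m + 1)), f.hom.f (m + 1) x = y := by
  let φ : ModuleCat.of k k ⟶ K.obj.X (m + 1) := ModuleCat.ofHom (LinearMap.toSpanSingleton k _ y)
  have hφ (j : ℕ) (_ : (ComplexShape.down ℕ).Rel m j) :
      (φ ≫ K.obj.d (m + 1) m) ≫ K.obj.d m j = 0 := by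
    rw [Category.assoc, K.obj.d_comp_d, comp_zero]
  let F : (disk k m).obj ⟶ K.obj := HomologicalComplex.mkHomFromDouble (down_rel m) (by simp)
    φ (φ ≫ K.obj.d (m + 1) m) (by simp) hφ
  have hF : F.f (m + 1) = (diskTop k m).hom ≫ φ :=
    HomologicalComplex.mkHomFromDouble_f₀ (down_rel m) (by simp) φ _ (by simp) hφ
  refine ⟨ObjectProperty.homMk F, (diskTop k m).inv (1 : k),
    (ConcreteCategory.congr_hom hF _).trans ?_⟩
  refine (congrArg φ (Iso.inv_hom_id_apply (diskTop k m) (1 : k))).trans ?_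
  exact one_smul k y

/-- The inclusion of zero into a disk is a trivial cofibration, and maps out of a disk hit any
prescribed element in its top degree. -/
lemma rlp_le_positiveSurjections :
    (degreewiseInjections k ⊓ quasiIsos k).rlp ≤ positiveSurjections k := by
  intro X Y p hp n hn y
  obtain ⟨m, rfl⟩ : ∃ m, n = m + 1 := ⟨n - 1, by omega⟩
  obtain ⟨f, x, hx⟩ := exists_hom_from_disk Y y
  have := hp (ObjectProperty.homMk 0 : zero k ⟶ disk k m) ⟨fun n ↦ by
    have := ModuleCat.subsingleton_of_isZero (isZero_zero_X (k := k) n)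
    exact Function.injective_of_subsingleton _, quasiIso_zero_to_disk m⟩
  have sq : CommSq (isZero_zero.to_ X) (ObjectProperty.homMk 0 : zero k ⟶ disk k m) p f :=
    ⟨isZero_zero.eq_of_src _ _⟩
  refine ⟨sq.lift.hom.f (m + 1) x, ?_⟩
  rw [← hx]
  exact congrArg (fun f ↦ f.hom.f (m + 1) x) sq.fac_right

section

attribute [local instance] ComonObj.instTensorUnit

lemma isOneConnected_unit : IsOneConnected (𝟙_ (FinTypeCh k)) where
  finrank_zero := by
    have e : ((𝟙_ (FinTypeCh k)).obj.X 0 : ModuleCat.{u} k) ≅ ModuleCat.of k k :=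
      HomologicalComplex.singleObjXSelf _ 0 _
    rw [e.toLinearEquiv.finrank_eq]
    exact Module.finrank_self k
  subsingleton_one := ModuleCat.subsingleton_of_isZero
    (HomologicalComplex.isZero_single_obj_X _ _ _ _ (by simp))

lemma rlp_hom_of_rlp {L : MorphismProperty (FinTypeCh k)}
    {N N' : RightComodule (𝟙_ (FinTypeCh k))} {p : N ⟶ N'}
    (hp : (L.inverseImage (RightComodule.forget _)).rlp p) : L.rlp p.hom := by
  intro A B i hi
  let i' : trivialComodule A ⟶ trivialComodule B := trivialHom i
  have : HasLiftingProperty i' p := hp i' hi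
  refine ⟨fun {t b} sq ↦ ⟨⟨?_⟩⟩⟩
  let t' : trivialComodule A ⟶ N := trivialHom t
  let b' : trivialComodule B ⟶ N' := trivialHom b
  have sq' : CommSq t' i' p b' := ⟨RightComodule.hom_ext sq.w⟩
  exact ⟨sq'.lift.hom, congrArg RightComodule.Hom.hom sq'.fac_left,
    congrArg RightComodule.Hom.hom sq'.fac_right⟩

/-- Comodules over the unit are just complexes, so the comodule factorizations specialize to those
needed for the base model structure. -/
lemma hasFactorization_of_unit {L R : MorphismProperty (FinTypeCh k)}
    {R' : MorphismProperty (RightComodule (𝟙_ (FinTypeCh k)))}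
    (h : MorphismProperty.HasFactorization (L.inverseImage (RightComodule.forget _)) R')
    (hR : ∀ ⦃N N' : RightComodule (𝟙_ (FinTypeCh k))⦄ (p : N ⟶ N'), R' p → R p.hom) :
    MorphismProperty.HasFactorization L R :=
  hasFactorization_of_exists (fun {K K'} f ↦ by
    let f' : trivialComodule K ⟶ trivialComodule K' := trivialHom f
    obtain ⟨F⟩ := h.nonempty_mapFactorizationData f'
    exact ⟨F.Z.X, F.i.hom, F.p.hom, congrArg RightComodule.Hom.hom F.fac, F.hi, hR _ F.hp⟩)

lemma hasFactorization_injections : MorphismProperty.HasFactorization (degreewiseInjections k)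
    ((degreewiseInjections k).rlp ⊓ quasiIsos k) :=
  hasFactorization_of_unit
    (hasFactorization_cofreeZ.{0} (trivialCoaugmentation _) isOneConnected_unit)
    (fun _ _ _ hp ↦ ⟨rlp_hom_of_rlp (postnikovTowers_le_rlp (cofreeZ_le_rlp _) _ hp.1), hp.2⟩)

lemma hasFactorization_trivialInjections :
    MorphismProperty.HasFactorization (degreewiseInjections k ⊓ quasiIsos k)
      (degreewiseInjections k ⊓ quasiIsos k).rlp :=
  hasFactorization_of_unit
    (hasFactorization_cofreeX.{0} (trivialCoaugmentation _) isOneConnected_unit)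
    (fun _ _ _ hp ↦ rlp_hom_of_rlp (postnikovTowers_le_rlp (cofreeX_le_rlp _) _ hp))

end

variable (k) in
/-- The injective model structure on finite-type chain complexes. -/
@[reducible]
def injectiveModelCategory : ModelCategory (FinTypeCh k) :=
  modelCategoryOfFactorizations hasFactorization_injections inf_le_left
    (rlp_le_of_hasFactorization hasFactorization_injections le_rfl)
    hasFactorization_trivialInjections

section

variable {C} (η : Coaugmentation C) (hC : IsOneConnected C)

lemma postnikovTowers_cofreeZ_le : postnikovTowers.{w} (cofreeZ C) ≤ (comoduleInjections C).rlp :=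
  postnikovTowers_le_rlp (cofreeZ_le_rlp C)

lemma postnikovTowers_cofreeX_le :
    postnikovTowers.{w} (cofreeX C) ≤ (comoduleInjections C ⊓ comoduleQuasiIsos C).rlp :=
  postnikovTowers_le_rlp (cofreeX_le_rlp C)

include η hC in
lemma rlp_comoduleInjections_le : (comoduleInjections C).rlp ≤ comoduleQuasiIsos C :=
  rlp_le_of_hasFactorization (hasFactorization_cofreeZ.{0} η hC) postnikovTowers_cofreeZ_le

lemma hasFactorization_mono {D : Type*} [Category* D] {L R R' : MorphismProperty D}
    (h : MorphismProperty.HasFactorization L R) (hR : R ≤ R') :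
    MorphismProperty.HasFactorization L R' where
  nonempty_mapFactorizationData f := by
    obtain ⟨F⟩ := h.nonempty_mapFactorizationData f
    exact ⟨{ F with hp := hR _ F.hp }⟩

/-- The left-induced model structure on comodules. -/
@[reducible]
def leftInducedModelCategory : ModelCategory (RightComodule C) :=
  modelCategoryOfFactorizations (I := comoduleInjections C) (W := comoduleQuasiIsos C)
    (hasFactorization_mono (hasFactorization_cofreeZ.{0} η hC) inf_le_left)
    postnikovTowers_cofreeZ_le (rlp_comoduleInjections_le η hC)
    (hasFactorization_mono (hasFactorization_cofreeX.{0} η hC) postnikovTowers_cofreeX_le)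

end

end FinTypeCh

theorem mainTheorem4 (k : Type u) [Field k] (C : FinTypeCh k) [ComonObj C]
    (η : Coaugmentation C) (hC : FinTypeCh.IsOneConnected C) :
    ∃ _ : ModelCategory (FinTypeCh k),
      weakEquivalences (FinTypeCh k) = FinTypeCh.quasiIsos k ∧
      cofibrations (FinTypeCh k) = FinTypeCh.degreewiseInjections k ∧
      fibrations (FinTypeCh k) = FinTypeCh.positiveSurjections k ∧
      ∃ _ : ModelCategory (RightComodule C),
        IsLeftInduced (RightComodule.forget C) ∧
        IsPostnikovPresentation.{w}
          ((FinTypeCh.generatingX k).strictMap (RightComodule.cofree C))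
          ((FinTypeCh.generatingZ k).strictMap (RightComodule.cofree C)) := by
  -- The model structures use towers indexed in universe `0` only to verify axioms that do not
  -- mention towers; the factorizations are redone in universe `w` for the presentation.
  have hZ := FinTypeCh.hasFactorization_mono
    (FinTypeCh.hasFactorization_cofreeZ.{w} η hC) inf_le_left
  refine ⟨FinTypeCh.injectiveModelCategory k, rfl, rfl,
    le_antisymm FinTypeCh.rlp_le_positiveSurjections FinTypeCh.positiveSurjections_le_rlp,
    FinTypeCh.leftInducedModelCategory η hC, ?_⟩
  let := FinTypeCh.injectiveModelCategory k
  let := FinTypeCh.leftInducedModelCategory η hC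
  refine ⟨⟨rfl, rfl⟩, ⟨?_, ?_, hZ, FinTypeCh.hasFactorization_cofreeX.{w} η hC⟩⟩
  · exact rlp_eq_retracts_of_hasFactorization (FinTypeCh.hasFactorization_cofreeX.{w} η hC)
      FinTypeCh.postnikovTowers_cofreeX_le
  · exact (rlp_inf_eq_rlp hZ FinTypeCh.postnikovTowers_cofreeZ_le
      (FinTypeCh.rlp_comoduleInjections_le η hC)).trans
      (rlp_eq_retracts_of_hasFactorization hZ FinTypeCh.postnikovTowers_cofreeZ_le)

end
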